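/- Let $M,N\ge 1$. There are $M$ agents and a set $Q$ of $N$ items. Agent $i$ has a monotone submodular valuation $w_i:2^Q\to\mathbb{R}_+$ with $w_i(\emptyset)=0$. For $S\subseteq X=[M]\times Q$ let $s_i=\{j:(i,j)\in S\}$ and $f(S)=\sum_{i=1}^M w_i(s_i)$. The set $S$ is feasible ($S\in\mathcal I$) if every item $j$ satisfies $|\{i:(i,j)\in S\}|\le 1$, and $f(\mathrm{OPT})=\max_{S\in\mathcal I}f(S)$. An algorithm accesses the valuations only through noisy value oracles $\hat w_i$ with $|\hat w_i(s)-w_i(s)|\le\varepsilon$ for all $i$ and all $s\subseteq Q$; the $\hat w_i$ are otherwise arbitrary and need not be monotone or submodular. Continuous greedy (with step size $\lambda=(MN)^{-2}$ and $Z=(MN)^5$ samples) is the following algorithm. Start with $y=0\in[0,1]^{M\times N}$ and perform $1/\lambda$ steps. In each step, for each agent $i$, draw $Z$ independent random sets $R\subseteq Q$, each containing every item $j$ independently with probability $y_{ij}$, and let $\hat\omega_{ij}$ be the average over these $Z$ sets of $\hat w_i(R\cup\{j\})-\hat w_i(R)$, where $\hat w_i(\emptyset)$ is replaced by the known value $0$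 without an oracle call and the terms with $j\in R$ are $0$ without a call for $R\cup\{j\}$; then, for each item $j$, pick $i_j\in\arg\max_i\hat\omega_{ij}$ (by any fixed tie-breaking rule) and increase $y_{i_j j}$ by $\lambda$. Finally apply randomized pipage rounding to $y$ to obtain $S$. **Theorem.** For every $\varepsilon\le 1/(MN)^2$, continuous greedy is an $(\alpha,\delta,\eta)$-resilient approximation algorithm for the submodular welfare (partition matroid) problem with $$\alpha=1-\tfrac1e,\qquad \delta=4MN+2M,\qquad \eta=(MN)^8 .$$ That is, for all such $w_i$ and $\hat w_i$, the algorithm makes at most $(MN)^8$ oracle calls, its output $S$ is always feasible, and $$\mathbb{E}[f(S)]\ \ge\ \Bigl(1-\tfrac1e\Bigr)f(\mathrm{OPT})-(4MN+2M)\,\varepsilon ,$$ the expectation being over the internal randomness of the algorithm. -/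

import Mathlib

noncomputable section

namespace SubmodularWelfare

/-! ### The submodular welfare problem

Agents are `Fin M`, items are `Fin N`; the ground set of assignments is `Fin M × Fin N`. -/

/-- A monotone submodular valuation on sets of items, normalised by `w ∅ = 0`
(hence nonnegative). -/
structure IsValuation {N : ℕ} (w : Finset (Fin N) → ℝ) : Prop where
  empty : w ∅ = 0
  mono : ∀ s t, s ⊆ t → w s ≤ w t
  submodular : ∀ s t, w (s ∪ t) + w (s ∩ t) ≤ w s + w t

/-- The bundle of items that the assignment `S` gives to agent `i`. -/
def bundle {M N : ℕ} (S : Finset (Fin M × Fin N)) (i : Fin M) : Finset (Fin N) :=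
  Finset.univ.filter fun j => (i, j) ∈ S

/-- The welfare `f(S) = ∑ i, w i (s_i)`. -/
def welfare {M N : ℕ} (w : Fin M → Finset (Fin N) → ℝ) (S : Finset (Fin M × Fin N)) : ℝ :=
  ∑ i, w i (bundle S i)

/-- Independence in the partition matroid: each item is given to at most one agent. -/
def Feasible {M N : ℕ} (S : Finset (Fin M × Fin N)) : Prop :=
  ∀ j : Fin N, (Finset.univ.filter fun i : Fin M => (i, j) ∈ S).card ≤ 1

theorem feasible_empty {M N : ℕ} : Feasible (∅ : Finset (Fin M × Fin N)) := by
  intro j; simp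

open Classical in
/-- `f(OPT)`, the largest welfare of a feasible assignment. -/
def optWelfare {M N : ℕ} (w : Fin M → Finset (Fin N) → ℝ) : ℝ :=
  (Finset.univ.filter fun S : Finset (Fin M × Fin N) => Feasible S).sup'
    ⟨∅, by simp [feasible_empty]⟩ (welfare w)

/-! ### Randomised algorithms with a value oracle -/

/-- A randomised algorithm with access to a value oracle for each of `M` agents on `N` items:
it returns a result, or queries the value of a bundle to an agent and continues with the answer,
or tosses a coin that shows `true` with probability `p` and continues with the outcome.
The algorithm learns about the valuations through queries only. -/
inductive OracleAlg (M N : ℕ) (α : Type) : Type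
  | ret (a : α) : OracleAlg M N α
  | query (i : Fin M) (s : Finset (Fin N)) (next : ℝ → OracleAlg M N α) : OracleAlg M N α
  | coin (p : unitInterval) (next : Bool → OracleAlg M N α) : OracleAlg M N α

/-- The distribution of a coin that shows `true` with probability `p`. -/
def coinLaw (p : unitInterval) : PMF Bool :=
  PMF.ofFintype (fun b => ENNReal.ofReal (if b then (p : ℝ) else 1 - (p : ℝ))) (by
    have h0 := p.2.1
    have h1 := p.2.2
    simp only [Fintype.sum_bool, if_true, Bool.false_eq_true, if_false]
    rw [← ENNReal.ofReal_add h0 (by linarith)]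
    simp)

namespace OracleAlg

variable {M N : ℕ} {α β : Type}

/-- Sequential composition. -/
def andThen : OracleAlg M N α → (α → OracleAlg M N β) → OracleAlg M N β
  | ret a, f => f a
  | query i s next, f => query i s fun v => andThen (next v) f
  | coin p next, f => coin p fun b => andThen (next b) f

instance : Monad (OracleAlg M N) where
  pure := ret
  bind := andThen

/-- The distribution of the result when queries are answered by `what` and the coins are
independent. -/
def law (what : Fin M → Finset (Fin N) → ℝ) : OracleAlg M N α → PMF α
  | ret a => PMF.pure a
  | query i s next => law what (next (what i s))
  | coin p next => (coinLaw p).bind fun b => law what (next b)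

/-- The number of oracle calls, in the worst case over the coins, when queries are answered
by `what`. -/
def calls (what : Fin M → Finset (Fin N) → ℝ) : OracleAlg M N α → ℕ
  | ret _ => 0
  | query i s next => calls what (next (what i s)) + 1
  | coin _ next => max (calls what (next true)) (calls what (next false))

/-- Toss a coin with success probability `p`, a real number in `[0, 1]`. -/
def flip (p : ℝ) : OracleAlg M N Bool :=
  coin (Set.projIcc 0 1 zero_le_one p) ret

/-- Query the value oracle. -/
def ask (i : Fin M) (s : Finset (Fin N)) : OracleAlg M N ℝ :=
  query i s ret

/-- Run `g 0, …, g (n - 1)` one after the other, with fresh coins, and collect the results. -/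
def tabulate : (n : ℕ) → (Fin n → OracleAlg M N α) → OracleAlg M N (Fin n → α)
  | 0, _ => pure Fin.elim0
  | n + 1, g => do
    let x ← g 0
    let xs ← tabulate n fun k => g k.succ
    pure (Fin.cons x xs)

end OracleAlg

/-! ### Continuous greedy -/

open OracleAlg

/-- A random set of items that contains each item `j` independently with probability `p j`. -/
def randomSet {M N : ℕ} (p : Fin N → ℝ) : OracleAlg M N (Finset (Fin N)) := do
  let b ← tabulate N fun j => flip (p j)
  pure (Finset.univ.filter fun j => b j = true)

/-- The oracle's value of `s` to agent `i`; the empty bundle is known to have value `0` and is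
not queried. -/
def value {M N : ℕ} (i : Fin M) (s : Finset (Fin N)) : OracleAlg M N ℝ :=
  if s = ∅ then pure 0 else ask i s

/-- Draw one random set `R` with marginals `p` and evaluate, for every item `j`, the marginal
value of `j` to agent `i` on top of `R` according to the oracle
(it is `0` without a query if `j ∈ R`). -/
def sampleMarginals {M N : ℕ} (i : Fin M) (p : Fin N → ℝ) : OracleAlg M N (Fin N → ℝ) := do
  let R ← randomSet p
  let base ← value i R
  tabulate N fun j =>
    if j ∈ R then pure 0 else do
      let v ← ask i (insert j R)
      pure (v - base)

/-- The average of `Z` independent samples of the marginal values of agent `i`: the estimates of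
`E[w_i(R ∪ {j}) - w_i(R)]`, for all items `j`. -/
def estimateMarginals {M N : ℕ} (Z : ℕ) (i : Fin M) (p : Fin N → ℝ) :
    OracleAlg M N (Fin N → ℝ) := do
  let x ← tabulate Z fun _ => sampleMarginals i p
  pure fun j => (∑ z, x z j) / (Z : ℝ)

/-- One step of length `stepSize`: estimate all marginals `ω i j` at `y`, and for each item `j`
raise the coordinate `(i_j, j)` of `y`, where `i_j = pick (fun i => ω i j)`. -/
def greedyStep {M N : ℕ} (pick : (Fin M → ℝ) → Fin M) (stepSize : ℝ) (Z : ℕ)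
    (y : Fin M → Fin N → ℝ) : OracleAlg M N (Fin M → Fin N → ℝ) := do
  let ω ← tabulate M fun i => estimateMarginals Z i (y i)
  pure fun i j => if i = pick (fun i' => ω i' j) then y i j + stepSize else y i j

/-- `n` consecutive steps from `y`. -/
def greedySteps {M N : ℕ} (pick : (Fin M → ℝ) → Fin M) (stepSize : ℝ) (Z : ℕ) :
    ℕ → (Fin M → Fin N → ℝ) → OracleAlg M N (Fin M → Fin N → ℝ)
  | 0, y => pure y
  | n + 1, y => do
    let y' ← greedyStep pick stepSize Z y
    greedySteps pick stepSize Z n y'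

/-- Randomised pipage rounding of one column `c` of a point of the partition matroid polytope.
All the mass of the agents treated so far sits at the agent `a` and equals `p`. A pipage step with
the next agent `b`, of mass `q = c b`, moves the pair of coordinates `(p, q)` of `(a, b)` along the
direction `e_a - e_b` to `(p + q, 0)` with probability `p / (p + q)` and to `(0, p + q)` otherwise,
which preserves the expectation. In the end a single coordinate is left, which is rounded to `1`
with probability equal to its mass. -/
def pipageFrom {M N : ℕ} (c : Fin M → ℝ) :
    List (Fin M) → Fin M → ℝ → OracleAlg M N (Option (Fin M))
  | [], a, p => do
    let b ← flip p
    pure (if b then some a else none)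
  | b :: l, a, p => do
    let keep ← flip (p / (p + c b))
    if keep then pipageFrom c l a (p + c b) else pipageFrom c l b (p + c b)

/-- Randomised pipage rounding of one column: the agent who receives the item, if any. -/
def pipageColumn {M N : ℕ} (c : Fin M → ℝ) : OracleAlg M N (Option (Fin M)) :=
  match List.finRange M with
  | [] => pure none
  | a :: l => pipageFrom c l a (c a)

/-- Randomised pipage rounding of a point of the partition matroid polytope, column by column. -/
def pipage {M N : ℕ} (y : Fin M → Fin N → ℝ) : OracleAlg M N (Finset (Fin M × Fin N)) := do
  let r ← tabulate N fun j => pipageColumn fun i => y i j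
  pure (Finset.univ.filter fun e => r e.2 = some e.1)

/-- Continuous greedy with `K` steps of size `1 / K` from `y = 0`, with `Z` random sets per agent
and step, followed by pipage rounding. -/
def continuousGreedy {M N : ℕ} (pick : (Fin M → ℝ) → Fin M) (K Z : ℕ) :
    OracleAlg M N (Finset (Fin M × Fin N)) := do
  let y ← greedySteps pick (1 / (K : ℝ)) Z K 0
  pipage y

/-! ### Resilience -/

/-- The expected true welfare of the assignment that `A` returns when its queries are answered
by `what`. -/
def expectedWelfare {M N : ℕ} (w what : Fin M → Finset (Fin N) → ℝ)
    (A : OracleAlg M N (Finset (Fin M × Fin N))) : ℝ :=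
  ∑ S, (A.law what S).toReal * welfare w S

/-- `A` is an `(α, δ, η)`-resilient approximation algorithm for the submodular welfare problem at
noise level `ε`: for all valuations `w` and every oracle `what` that is within `ε` of `w`
(and otherwise arbitrary), `A` makes at most `η` oracle calls, returns a feasible assignment, and
`E[f(S)] ≥ α f(OPT) - δ ε`. -/
def IsResilient {M N : ℕ} (A : OracleAlg M N (Finset (Fin M × Fin N)))
    (α δ : ℝ) (η : ℕ) (ε : ℝ) : Prop :=
  ∀ w what : Fin M → Finset (Fin N) → ℝ,
    (∀ i, IsValuation (w i)) →
    (∀ i s, |what i s - w i s| ≤ ε) →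
      A.calls what ≤ η ∧
      (∀ S ∈ (A.law what).support, Feasible S) ∧
      α * optWelfare w - δ * ε ≤ expectedWelfare w what A

end SubmodularWelfare

end

/-! Feasibility and the call count are structural. Rounding gives each item one `Option` agent. A
sample costs at most N calls, because an empty `R` saves the base query and a nonempty one saves a
marginal query; the total is K·M·Z·N = (MN)^8. Rounding loses nothing in expectation: columns are
rounded independently with the right marginals and the welfare is a sum over agents, so the expected
welfare is F(y), the sum of the multilinear extensions (`expect_pipage`).

For M, N ≥ 2, let Ω be the sum over items of the best expected marginal. Submodularity gives OPT - F
≤ Ω (`optWelfare_le_add_bestMarginal`). A step of length 1/K gains about Ω/K, which yields 1 - 1/e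
up to two relative losses: second-order effects of the step (`stepLoss`), and choosing agents by
sampled marginals (`samplingLoss`, from the variance bound `expect_chosen_le`). Oracle noise costs
4ε per item and step. The theorem allows no loss in the factor 1 - 1/e, so the first two losses must
be paid for.

The payment is a gain that the usual analysis discards. Raising a coordinate t by 1/K adds the item,
when it is absent, with probability 1/(K(1-t)) ≥ (1+t)/K, so the step earns a bonus factor 1 +
min(t, 1/M). A column distributes k raises among M agents, and by convexity its collected bonus is
least when they are spread evenly (`sum_evenBonus_le`). Best marginals only decrease over time, so
summation by parts, with the nonnegative potential Σ_j excess_j · bestMarginal_j, bounds the total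
weighted bonus from below (`expect_excess_raise_le`). `recursion_bound` solves the resulting
recursion, and `gainOutweighsLoss` checks that the gain, at least 0.2/M outside the case M = N = 2,
covers losses of order 1/M².

The cases M = 1 (every coordinate ends at 1) and N = 1 (F is linear along the steps and selection
has no harmful bias) have simpler arguments. -/

noncomputable section
namespace SubmodularWelfare
-- Expectation, support and call count of an oracle algorithm
namespace OracleAlg

variable {M N : ℕ} {α β : Type}

/-- The expectation of `f` of the result when queries are answered by `what`. -/
def expect (what : Fin M → Finset (Fin N) → ℝ) : OracleAlg M N α → (α → ℝ) → ℝ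
  | ret a, f => f a
  | query i s next, f => expect what (next (what i s)) f
  | coin p next, f =>
      (p : ℝ) * expect what (next true) f + (1 - (p : ℝ)) * expect what (next false) f

/-- Every result that some outcome of the coins leads to satisfies `P`. -/
def Always (what : Fin M → Finset (Fin N) → ℝ) (P : α → Prop) : OracleAlg M N α → Prop
  | ret a => P a
  | query i s next => Always what P (next (what i s))
  | coin _ next => Always what P (next true) ∧ Always what P (next false)

variable {what : Fin M → Finset (Fin N) → ℝ}

@[simp] theorem expect_pure (a : α) (f : α → ℝ) :
    expect what (pure a : OracleAlg M N α) f = f a := rfl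

@[simp] theorem always_pure (a : α) (P : α → Prop) :
    Always what P (pure a : OracleAlg M N α) ↔ P a := Iff.rfl

theorem expect_bind (A : OracleAlg M N α) (g : α → OracleAlg M N β) (f : β → ℝ) :
    expect what (A >>= g) f = expect what A fun a => expect what (g a) f := by
  change expect what (andThen A g) f = _
  induction A with
  | ret a => rfl
  | query i s next ih => exact ih _
  | coin p next ih => simp only [andThen, expect, ih]

theorem always_bind {A : OracleAlg M N α} {g : α → OracleAlg M N β} {P : α → Prop} {Q : β → Prop}
    (hA : Always what P A) (hg : ∀ a, P a → Always what Q (g a)) : Always what Q (A >>= g) := by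
  change Always what Q (andThen A g)
  induction A with
  | ret a => exact hg a hA
  | query i s next ih => exact ih _ hA
  | coin p next ih => exact ⟨ih _ hA.1, ih _ hA.2⟩

theorem Always.of_forall {P : α → Prop} (h : ∀ a, P a) (A : OracleAlg M N α) :
    Always what P A := by
  induction A with
  | ret a => exact h a
  | query i s next ih => exact ih _
  | coin p next ih => exact ⟨ih _, ih _⟩

theorem Always.imp {P Q : α → Prop} {A : OracleAlg M N α} (hA : Always what P A)
    (h : ∀ a, P a → Q a) : Always what Q A := by
  induction A with
  | ret a => exact h a hA
  | query i s next ih => exact ih _ hA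
  | coin p next ih => exact ⟨ih _ hA.1, ih _ hA.2⟩

theorem expect_mono_of_always {A : OracleAlg M N α} {f g : α → ℝ}
    (h : Always what (fun a => f a ≤ g a) A) : expect what A f ≤ expect what A g := by
  induction A with
  | ret a => exact h
  | query i s next ih => exact ih _ h
  | coin p next ih =>
    exact add_le_add (mul_le_mul_of_nonneg_left (ih _ h.1) p.2.1)
      (mul_le_mul_of_nonneg_left (ih _ h.2) (sub_nonneg.2 p.2.2))

theorem expect_mono (A : OracleAlg M N α) {f g : α → ℝ} (h : ∀ a, f a ≤ g a) :
    expect what A f ≤ expect what A g :=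
  expect_mono_of_always (Always.of_forall h A)

theorem expect_congr_of_always {A : OracleAlg M N α} {f g : α → ℝ}
    (h : Always what (fun a => f a = g a) A) : expect what A f = expect what A g :=
  le_antisymm (expect_mono_of_always (h.imp fun _ e => e.le))
    (expect_mono_of_always (h.imp fun _ e => e.ge))

@[simp] theorem expect_const (A : OracleAlg M N α) (c : ℝ) :
    expect what A (fun _ => c) = c := by
  induction A with
  | ret a => rfl
  | query i s next ih => exact ih _
  | coin p next ih => simp only [expect, ih]; ring

theorem expect_add (A : OracleAlg M N α) (f g : α → ℝ) :
    expect what A (fun a => f a + g a) = expect what A f + expect what A g := by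
  induction A with
  | ret a => rfl
  | query i s next ih => exact ih _
  | coin p next ih => simp only [expect, ih]; ring

theorem expect_const_mul (A : OracleAlg M N α) (c : ℝ) (f : α → ℝ) :
    expect what A (fun a => c * f a) = c * expect what A f := by
  induction A with
  | ret a => rfl
  | query i s next ih => exact ih _
  | coin p next ih => simp only [expect, ih]; ring

theorem expect_mul_const (A : OracleAlg M N α) (c : ℝ) (f : α → ℝ) :
    expect what A (fun a => f a * c) = expect what A f * c := by
  simp only [mul_comm _ c, expect_const_mul]

theorem expect_sub (A : OracleAlg M N α) (f g : α → ℝ) :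
    expect what A (fun a => f a - g a) = expect what A f - expect what A g := by
  induction A with
  | ret a => rfl
  | query i s next ih => exact ih _
  | coin p next ih => simp only [expect, ih]; ring

theorem expect_sum {ι : Type*} (s : Finset ι) (A : OracleAlg M N α) (f : ι → α → ℝ) :
    expect what A (fun a => ∑ i ∈ s, f i a) = ∑ i ∈ s, expect what A (f i) := by
  classical
  induction s using Finset.induction_on with
  | empty => simp
  | insert a s h ih => simp only [Finset.sum_insert h, expect_add, ih]

theorem sq_expect_le (A : OracleAlg M N α) (f : α → ℝ) :
    expect what A f ^ 2 ≤ expect what A fun a => f a ^ 2 := by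
  have h : 0 ≤ expect what A fun a => (f a - expect what A f) ^ 2 := by
    rw [← expect_const (what := what) A 0]
    exact expect_mono A fun a => sq_nonneg _
  have e : (fun a => (f a - expect what A f) ^ 2) =
      fun a => f a ^ 2 - 2 * expect what A f * f a + expect what A f ^ 2 := by
    funext a; ring
  rw [e, expect_add, expect_sub, expect_const_mul, expect_const] at h
  linarith

theorem expect_flip {p : ℝ} (h0 : 0 ≤ p) (h1 : p ≤ 1) (f : Bool → ℝ) :
    expect what (flip p : OracleAlg M N Bool) f = p * f true + (1 - p) * f false := by
  simp only [flip, expect, Set.projIcc_of_mem zero_le_one (⟨h0, h1⟩ : p ∈ Set.Icc (0 : ℝ) 1)]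

theorem expect_tabulate_succ (n : ℕ) (g : Fin (n + 1) → OracleAlg M N α)
    (f : (Fin (n + 1) → α) → ℝ) :
    expect what (tabulate (n + 1) g) f =
      expect what (g 0) fun a => expect what (tabulate n fun k => g k.succ) fun x =>
        f (Fin.cons a x) := by
  simp only [tabulate, expect_bind, expect_pure]

/-- This is the independence of the runs. Marginals, products of two coordinates and variances all
follow by setting the remaining factors to 1. -/
theorem expect_tabulate_prod {n : ℕ} (g : Fin n → OracleAlg M N α) (f : Fin n → α → ℝ) :
    expect what (tabulate n g) (fun x => ∏ k, f k (x k)) = ∏ k, expect what (g k) (f k) := by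
  induction n with
  | zero => simp [tabulate]
  | succ n ih =>
    rw [expect_tabulate_succ, Fin.prod_univ_succ]
    simp only [Fin.prod_univ_succ, Fin.cons_zero, Fin.cons_succ, expect_const_mul,
      ih (fun k => g k.succ) (fun k => f k.succ), expect_mul_const]

theorem expect_tabulate_apply {n : ℕ} (g : Fin n → OracleAlg M N α) (k : Fin n) (f : α → ℝ) :
    expect what (tabulate n g) (fun x => f (x k)) = expect what (g k) f := by
  have h := expect_tabulate_prod (what := what) g fun l a => if l = k then f a else 1
  have e : ∀ l, expect what (g l) (fun a => if l = k then f a else 1) =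
      if l = k then expect what (g l) f else 1 := fun l => by
    by_cases hl : l = k <;> simp [hl]
  simp only [e, Finset.prod_ite_eq', Finset.mem_univ, if_true] at h
  exact h

theorem expect_tabulate_mul {n : ℕ} (g : Fin n → OracleAlg M N α) {k l : Fin n} (hkl : k ≠ l)
    (f h : α → ℝ) :
    expect what (tabulate n g) (fun x => f (x k) * h (x l)) =
      expect what (g k) f * expect what (g l) h := by
  have H := expect_tabulate_prod (what := what) g fun m a =>
    (if m = k then f a else 1) * (if m = l then h a else 1)
  have e : ∀ m, expect what (g m)
        (fun a => (if m = k then f a else 1) * (if m = l then h a else 1)) =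
      (if m = k then expect what (g m) f else 1) * (if m = l then expect what (g m) h else 1) :=
    fun m => by
      by_cases hk : m = k
      · have hl : m ≠ l := hk ▸ hkl
        simp [hk, hkl]
      · by_cases hl : m = l <;> simp [hk, hl]
        simp [hkl.symm]
  simp only [e, Finset.prod_mul_distrib, Finset.prod_ite_eq', Finset.mem_univ, if_true] at H
  exact H

/-- The second moment of a sum of independent centred random variables. -/
theorem expect_tabulate_sq_sum {n : ℕ} (g : Fin n → OracleAlg M N α) (f : Fin n → α → ℝ)
    (h0 : ∀ k, expect what (g k) (f k) = 0) :
    expect what (tabulate n g) (fun x => (∑ k, f k (x k)) ^ 2) =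
      ∑ k, expect what (g k) fun a => f k a ^ 2 := by
  simp only [sq, Finset.sum_mul_sum, expect_sum]
  refine Finset.sum_congr rfl fun k _ => ?_
  rw [Finset.sum_eq_single k]
  · exact expect_tabulate_apply g k fun a => f k a * f k a
  · intro l _ hl
    rw [expect_tabulate_mul g hl.symm (f k) (f l), h0, zero_mul]
  · simp

/-- A change of variables. It allows runs that query the oracle to be replaced by query-free random
draws followed by a deterministic function of the draw. -/
theorem expect_tabulate_map {γ : Type} {n : ℕ} (g : Fin n → OracleAlg M N α)
    (g' : Fin n → OracleAlg M N γ) (φ : Fin n → γ → α)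
    (h : ∀ k (f : α → ℝ), expect what (g k) f = expect what (g' k) fun c => f (φ k c))
    (f : (Fin n → α) → ℝ) :
    expect what (tabulate n g) f =
      expect what (tabulate n g') fun x => f fun k => φ k (x k) := by
  induction n with
  | zero =>
    simp only [tabulate, expect_pure]
    congr 1
    funext k
    exact k.elim0
  | succ n ih =>
    rw [expect_tabulate_succ, expect_tabulate_succ, h]
    congr 1
    funext a
    rw [ih (fun k => g k.succ) (fun k => g' k.succ) (fun k => φ k.succ) fun k => h k.succ]
    congr 1
    funext x
    congr 1
    funext k
    refine Fin.cases ?_ (fun k => ?_) k <;> simp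

theorem always_mem_support {P : α → Prop} {A : OracleAlg M N α} (h : Always what P A) {a : α}
    (ha : a ∈ (A.law what).support) : P a := by
  induction A with
  | ret b =>
    simp only [law, PMF.support_pure, Set.mem_singleton_iff] at ha
    exact ha ▸ h
  | query i s next ih => exact ih _ h ha
  | coin p next ih =>
    simp only [law, PMF.mem_support_bind_iff] at ha
    obtain ⟨b, -, hb⟩ := ha
    cases b
    · exact ih _ h.2 hb
    · exact ih _ h.1 hb

theorem sum_law_mul [Fintype α] (A : OracleAlg M N α) (f : α → ℝ) :
    ∑ a, (A.law what a).toReal * f a = expect what A f := by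
  classical
  induction A with
  | ret b =>
    simp only [law, PMF.pure_apply, expect]
    rw [Finset.sum_eq_single b]
    · simp
    · intro c _ hc; simp [hc]
    · simp
  | query i s next ih => exact ih _
  | coin p next ih =>
    have h0 := p.2.1
    have h1 : 0 ≤ 1 - (p : ℝ) := sub_nonneg.2 p.2.2
    simp only [law, expect, ← ih, PMF.bind_apply, tsum_fintype, Fintype.sum_bool, Finset.mul_sum,
      ← Finset.sum_add_distrib]
    refine Finset.sum_congr rfl fun a _ => ?_
    rw [ENNReal.toReal_add (ENNReal.mul_ne_top (PMF.apply_ne_top _ _) (PMF.apply_ne_top _ _))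
      (ENNReal.mul_ne_top (PMF.apply_ne_top _ _) (PMF.apply_ne_top _ _)), ENNReal.toReal_mul,
      ENNReal.toReal_mul]
    simp only [coinLaw, PMF.ofFintype_apply, if_true, Bool.false_eq_true, if_false,
      ENNReal.toReal_ofReal h0, ENNReal.toReal_ofReal h1]
    ring

theorem calls_bind_le (A : OracleAlg M N α) (g : α → OracleAlg M N β) {n : ℕ}
    (h : ∀ a, calls what (g a) ≤ n) : calls what (A >>= g) ≤ calls what A + n := by
  change calls what (andThen A g) ≤ _
  induction A with
  | ret a => simpa [andThen, calls] using h a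
  | query i s next ih =>
    have := ih (what i s)
    simp only [andThen, calls]
    omega
  | coin p next ih =>
    have h1 := ih true
    have h2 := ih false
    simp only [andThen, calls]
    omega

@[simp] theorem calls_pure (a : α) : calls what (pure a : OracleAlg M N α) = 0 := rfl

theorem calls_flip (p : ℝ) : calls what (flip p : OracleAlg M N Bool) = 0 := rfl

theorem calls_tabulate_le {n : ℕ} (g : Fin n → OracleAlg M N α) (m : Fin n → ℕ)
    (h : ∀ k, calls what (g k) ≤ m k) : calls what (tabulate n g) ≤ ∑ k, m k := by
  induction n with
  | zero => simp [tabulate]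
  | succ n ih =>
    rw [Fin.sum_univ_succ]
    refine (calls_bind_le (n := ∑ k : Fin n, m k.succ) _ _ fun a => ?_).trans
      (Nat.add_le_add_right (h 0) _)
    refine (calls_bind_le (n := 0) _ _ fun x => ?_).trans (ih _ _ fun k => h k.succ)
    simp

end OracleAlg

/-! ### Number of oracle calls, and feasibility -/

open OracleAlg

variable {M N : ℕ} {what : Fin M → Finset (Fin N) → ℝ}

theorem calls_randomSet (p : Fin N → ℝ) :
    calls what (randomSet p : OracleAlg M N _) = 0 := by
  refine Nat.le_zero.1 ((calls_bind_le (n := 0) _ _ fun b => ?_).trans ?_)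
  · simp
  · refine (calls_tabulate_le _ (fun _ => 0) fun k => ?_).trans (by simp)
    rw [calls_flip]

theorem calls_sampleMarginals_le (i : Fin M) (p : Fin N → ℝ) :
    calls what (sampleMarginals i p) ≤ N := by
  refine (calls_bind_le (n := N) _ _ fun R => ?_).trans (by rw [calls_randomSet, zero_add])
  have key : ∀ base : ℝ, calls what (tabulate N fun j =>
      if j ∈ R then (pure 0 : OracleAlg M N ℝ) else do
        let v ← ask i (insert j R)
        pure (v - base)) ≤ N - R.card := by
    intro base
    refine (calls_tabulate_le _ (fun j => if j ∈ R then 0 else 1) fun j => ?_).trans ?_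
    · by_cases hj : j ∈ R
      · simp [hj]
      · simp only [hj, if_false]
        exact le_rfl
    · have h := Finset.sum_boole (R := ℕ) (fun j : Fin N => j ∉ R) Finset.univ
      have e : ∀ j, (if j ∈ R then 0 else 1 : ℕ) = if j ∉ R then 1 else 0 := fun j => by
        by_cases hj : j ∈ R <;> simp [hj]
      have hc : (Finset.univ.filter fun j : Fin N => j ∉ R) = Rᶜ := by ext; simp
      simp only [e, h, hc, Finset.card_compl, Fintype.card_fin, Nat.cast_id, le_refl]
  -- The base query costs 1 only when `R` is nonempty, and then at least one item needs no marginal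
  -- query, so 1 + (N - |R|) ≤ N.
  refine (calls_bind_le (n := N - R.card) _ _ key).trans ?_
  have hR : R.card ≤ N := by simpa using Finset.card_le_univ R
  unfold value
  split_ifs with h
  · simp [h]
  · have : 0 < R.card := Finset.card_pos.2 (Finset.nonempty_iff_ne_empty.2 h)
    change 1 + _ ≤ _
    omega

theorem calls_greedyStep_le (pick : (Fin M → ℝ) → Fin M) (l : ℝ) (Z : ℕ)
    (y : Fin M → Fin N → ℝ) : calls what (greedyStep pick l Z y) ≤ M * (Z * N) := by
  refine (calls_bind_le (n := 0) _ _ fun ω => by simp).trans ?_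
  refine (calls_tabulate_le _ (fun _ => Z * N) fun i => ?_).trans (by simp)
  refine (calls_bind_le (n := 0) _ _ fun ω => by simp).trans ?_
  refine (calls_tabulate_le _ (fun _ => N) fun i => calls_sampleMarginals_le _ _).trans (by simp)

theorem calls_greedySteps_le (pick : (Fin M → ℝ) → Fin M) (l : ℝ) (Z n : ℕ)
    (y : Fin M → Fin N → ℝ) :
    calls what (greedySteps pick l Z n y) ≤ n * (M * (Z * N)) := by
  induction n generalizing y with
  | zero => simp [greedySteps]
  | succ n ih =>
    refine (calls_bind_le _ _ ih).trans ?_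
    have := calls_greedyStep_le (what := what) pick l Z y
    linarith

theorem calls_pipageFrom (c : Fin M → ℝ) (l : List (Fin M)) (a : Fin M) (p : ℝ) :
    calls what (pipageFrom (N := N) c l a p) = 0 := by
  induction l generalizing a p with
  | nil =>
    unfold pipageFrom
    exact Nat.le_zero.1 ((calls_bind_le (n := 0) _ _ fun b => by simp).trans
      (by rw [calls_flip]))
  | cons b l ih =>
    unfold pipageFrom
    refine Nat.le_zero.1 ((calls_bind_le (n := 0) _ _ fun keep => ?_).trans
      (by rw [calls_flip]))
    cases keep <;> simp [ih]

theorem calls_pipage (y : Fin M → Fin N → ℝ) : calls what (pipage y) = 0 := by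
  refine Nat.le_zero.1 ((calls_bind_le (n := 0) _ _ fun b => by simp).trans ?_)
  refine (calls_tabulate_le _ (fun _ => 0) fun j => ?_).trans (by simp)
  unfold pipageColumn
  split
  · simp
  · rw [calls_pipageFrom]

theorem calls_continuousGreedy_le (pick : (Fin M → ℝ) → Fin M) (K Z : ℕ) :
    calls what (continuousGreedy (N := N) pick K Z) ≤ K * (M * (Z * N)) :=
  (calls_bind_le (n := 0) _ _ fun y => (calls_pipage y).le).trans
    (calls_greedySteps_le _ _ _ _ _)

theorem always_feasible_continuousGreedy (pick : (Fin M → ℝ) → Fin M) (K Z : ℕ) :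
    Always what Feasible (continuousGreedy (N := N) pick K Z) := by
  refine always_bind (P := fun _ => True) (Always.of_forall (fun _ => trivial) _) fun y _ => ?_
  refine always_bind (P := fun _ => True) (Always.of_forall (fun _ => trivial) _) fun r _ => ?_
  rw [always_pure]
  intro j
  refine Finset.card_le_one.2 fun a ha b hb => ?_
  simp only [Finset.mem_filter, Finset.mem_univ, true_and] at ha hb
  exact Option.some.inj (ha.symm.trans hb)

end SubmodularWelfare
end

noncomputable section
namespace SubmodularWelfare
open OracleAlg

/-! ### The multilinear extension -/

section Multilinear

variable {ι : Type*} [Fintype ι] [DecidableEq ι]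

/-- The multilinear extension of `f` at `p`: the expectation of `f` of a random set that contains
each `j` independently with probability `p j`. -/
def multilinear (p : ι → ℝ) (f : Finset ι → ℝ) : ℝ :=
  ∑ S, (∏ j, if j ∈ S then p j else 1 - p j) * f S

theorem multilinear_add (p : ι → ℝ) (f g : Finset ι → ℝ) :
    multilinear p (fun S => f S + g S) = multilinear p f + multilinear p g := by
  simp only [multilinear, mul_add, Finset.sum_add_distrib]

theorem multilinear_sub (p : ι → ℝ) (f g : Finset ι → ℝ) :
    multilinear p (fun S => f S - g S) = multilinear p f - multilinear p g := by
  simp only [multilinear, mul_sub, Finset.sum_sub_distrib]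

theorem multilinear_const_mul (p : ι → ℝ) (c : ℝ) (f : Finset ι → ℝ) :
    multilinear p (fun S => c * f S) = c * multilinear p f := by
  simp only [multilinear, Finset.mul_sum, mul_left_comm]

theorem multilinear_sum {κ : Type*} (s : Finset κ) (p : ι → ℝ) (f : κ → Finset ι → ℝ) :
    multilinear p (fun S => ∑ k ∈ s, f k S) = ∑ k ∈ s, multilinear p (f k) := by
  simp only [multilinear, Finset.mul_sum]
  exact Finset.sum_comm

theorem multilinear_const (p : ι → ℝ) (c : ℝ) : multilinear p (fun _ => c) = c := by
  have h := Finset.prod_add p (fun j => 1 - p j) Finset.univ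
  simp only [add_sub_cancel, Finset.prod_const_one, Finset.powerset_univ] at h
  rw [multilinear, ← Finset.sum_mul]
  have e : ∀ S : Finset ι, (∏ j, if j ∈ S then p j else 1 - p j) =
      (∏ j ∈ S, p j) * ∏ j ∈ Finset.univ \ S, (1 - p j) := fun S => by
    rw [Finset.prod_ite]
    congr 1
    · congr 1; ext; simp
    · congr 1; ext; simp
  simp only [e, ← h, one_mul]

theorem multilinear_mono {p : ι → ℝ} (h0 : ∀ j, 0 ≤ p j) (h1 : ∀ j, p j ≤ 1)
    {f g : Finset ι → ℝ} (h : ∀ S, f S ≤ g S) : multilinear p f ≤ multilinear p g := by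
  refine Finset.sum_le_sum fun S _ => mul_le_mul_of_nonneg_left (h S) ?_
  refine Finset.prod_nonneg fun j _ => ?_
  split_ifs
  · exact h0 j
  · exact sub_nonneg.2 (h1 j)

theorem multilinear_nonneg {p : ι → ℝ} (h0 : ∀ j, 0 ≤ p j) (h1 : ∀ j, p j ≤ 1)
    {f : Finset ι → ℝ} (h : ∀ S, 0 ≤ f S) : 0 ≤ multilinear p f := by
  rw [← multilinear_const p 0]
  exact multilinear_mono h0 h1 h

/-- Conditioning on whether `k` belongs to the random set; this exhibits the dependence on `p k` as
affine. -/
theorem multilinear_eq_sum_erase (p : ι → ℝ) (f : Finset ι → ℝ) (k : ι) :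
    multilinear p f = ∑ S ∈ (Finset.univ.erase k).powerset,
      (∏ j ∈ Finset.univ.erase k, if j ∈ S then p j else 1 - p j) *
        ((1 - p k) * f S + p k * f (insert k S)) := by
  have hk : k ∉ Finset.univ.erase k := Finset.notMem_erase k _
  have hu : (Finset.univ : Finset ι) = insert k (Finset.univ.erase k) := by simp
  rw [multilinear, ← Finset.powerset_univ]
  conv_lhs => rw [hu]
  rw [Finset.sum_powerset_insert hk, ← Finset.sum_add_distrib]
  refine Finset.sum_congr rfl fun S hS => ?_
  have hkS : k ∉ S := fun h => hk (Finset.mem_powerset.1 hS h)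
  rw [Finset.prod_insert hk, Finset.prod_insert hk]
  have e : (∏ j ∈ Finset.univ.erase k, if j ∈ insert k S then p j else 1 - p j) =
      ∏ j ∈ Finset.univ.erase k, if j ∈ S then p j else 1 - p j := by
    refine Finset.prod_congr rfl fun j hj => ?_
    simp [Finset.ne_of_mem_erase hj]
  rw [e]
  simp only [hkS, if_false, Finset.mem_insert_self, if_true]
  ring

theorem multilinear_update (p : ι → ℝ) (f : Finset ι → ℝ) (k : ι) (q : ℝ) :
    multilinear (Function.update p k q) f = ∑ S ∈ (Finset.univ.erase k).powerset,
      (∏ j ∈ Finset.univ.erase k, if j ∈ S then p j else 1 - p j) *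
        ((1 - q) * f S + q * f (insert k S)) := by
  rw [multilinear_eq_sum_erase _ f k]
  refine Finset.sum_congr rfl fun S _ => ?_
  rw [Function.update_self]
  congr 1
  refine Finset.prod_congr rfl fun j hj => ?_
  rw [Function.update_of_ne (Finset.ne_of_mem_erase hj)]

/-- Adding `k` to the random set with probability `u`, independently of the rest. -/
theorem multilinear_update_add (p : ι → ℝ) (f : Finset ι → ℝ) (k : ι) (u : ℝ) :
    multilinear (Function.update p k (p k + u * (1 - p k))) f =
      (1 - u) * multilinear p f + u * multilinear p fun S => f (insert k S) := by
  rw [multilinear_update, multilinear_eq_sum_erase p f k, multilinear_eq_sum_erase p _ k,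
    Finset.mul_sum, Finset.mul_sum, ← Finset.sum_add_distrib]
  refine Finset.sum_congr rfl fun S _ => ?_
  rw [Finset.insert_idem]
  ring

theorem multilinear_update_le {p : ι → ℝ} (h0 : ∀ j, 0 ≤ p j) (h1 : ∀ j, p j ≤ 1)
    {f : Finset ι → ℝ} (hf : Monotone f) {k : ι} {q : ℝ} (hq : p k ≤ q) :
    multilinear p f ≤ multilinear (Function.update p k q) f := by
  rw [multilinear_update, multilinear_eq_sum_erase p f k]
  refine Finset.sum_le_sum fun S _ => mul_le_mul_of_nonneg_left ?_ ?_
  · have := hf (Finset.subset_insert k S)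
    nlinarith
  · refine Finset.prod_nonneg fun j _ => ?_
    split_ifs
    · exact h0 j
    · exact sub_nonneg.2 (h1 j)

theorem multilinear_le_of_le {p q : ι → ℝ} (h0 : ∀ j, 0 ≤ p j) (h1 : ∀ j, q j ≤ 1)
    (hpq : ∀ j, p j ≤ q j) {f : Finset ι → ℝ} (hf : Monotone f) :
    multilinear p f ≤ multilinear q f := by
  have H : ∀ J : Finset ι, multilinear p f ≤ multilinear (J.piecewise q p) f := by
    intro J
    induction J using Finset.induction_on with
    | empty => simp
    | insert k J hk ih =>
      refine ih.trans ?_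
      rw [Finset.piecewise_insert]
      refine multilinear_update_le (fun j => ?_) (fun j => ?_) hf ?_
      · by_cases hj : j ∈ J <;> simp [hj, h0 j, (h0 j).trans (hpq j)]
      · by_cases hj : j ∈ J <;> simp [hj, h1 j, (hpq j).trans (h1 j)]
      · simpa [hk] using hpq k
  simpa using H Finset.univ

theorem multilinear_ge_of_le {p q : ι → ℝ} (h0 : ∀ j, 0 ≤ p j) (h1 : ∀ j, q j ≤ 1)
    (hpq : ∀ j, p j ≤ q j) {f : Finset ι → ℝ} (hf : Antitone f) :
    multilinear q f ≤ multilinear p f := by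
  have h := multilinear_le_of_le h0 h1 hpq (f := fun S => -1 * f S)
    fun s t hst => by have := hf hst; simp only; linarith
  rw [multilinear_const_mul, multilinear_const_mul] at h
  linarith

theorem multilinear_one (f : Finset ι → ℝ) : multilinear (fun _ => 1) f = f Finset.univ := by
  rw [multilinear, Finset.sum_eq_single Finset.univ]
  · simp
  · intro S _ hS
    obtain ⟨j, hj⟩ : ∃ j, j ∉ S := by
      by_contra! h
      exact hS (Finset.eq_univ_iff_forall.2 h)
    rw [Finset.prod_eq_zero (Finset.mem_univ j) (by simp [hj]), zero_mul]
  · simp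

end Multilinear

/-! ### Random sets and pipage rounding -/

variable {M N : ℕ} {α : Type} {what : Fin M → Finset (Fin N) → ℝ}

/-- Independent runs make the membership events independent, so only their probabilities matter. The
proof writes `f` of the random set as a sum over all `S` of `f S` times a product of indicators. -/
theorem expect_tabulate_filter (g : Fin N → OracleAlg M N α) (q : Fin N → α → Prop)
    [∀ j a, Decidable (q j a)] (f : Finset (Fin N) → ℝ) :
    expect what (tabulate N g) (fun x => f (Finset.univ.filter fun j => q j (x j))) =
      multilinear (fun j => expect what (g j) fun a => if q j a then 1 else 0) f := by
  have key : ∀ x : Fin N → α, f (Finset.univ.filter fun j => q j (x j)) =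
      ∑ S, f S * ∏ j, if j ∈ S then (if q j (x j) then (1 : ℝ) else 0)
        else 1 - (if q j (x j) then 1 else 0) := by
    intro x
    rw [Finset.sum_eq_single (Finset.univ.filter fun j => q j (x j)), Finset.prod_eq_one, mul_one]
    · intro j _
      by_cases hj : q j (x j) <;> simp [hj]
    · intro S _ hS
      obtain ⟨j, hj⟩ : ∃ j, ¬ (j ∈ S ↔ q j (x j)) := by
        by_contra! h
        exact hS (by ext j; simp [h j])
      rw [Finset.prod_eq_zero (Finset.mem_univ j), mul_zero]
      by_cases h1 : j ∈ S <;> by_cases h2 : q j (x j) <;> simp_all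
    · simp
  simp only [key, expect_sum, expect_const_mul]
  refine Finset.sum_congr rfl fun S _ => ?_
  rw [mul_comm]
  congr 1
  have h := expect_tabulate_prod (what := what) g fun j a =>
    if j ∈ S then (if q j a then (1 : ℝ) else 0) else 1 - (if q j a then 1 else 0)
  rw [h]
  refine Finset.prod_congr rfl fun j _ => ?_
  by_cases hj : j ∈ S
  · simp only [hj, if_true]
  · simp only [hj, if_false, expect_sub, expect_const]

theorem expect_randomSet {p : Fin N → ℝ} (h0 : ∀ j, 0 ≤ p j) (h1 : ∀ j, p j ≤ 1)
    (f : Finset (Fin N) → ℝ) :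
    expect what (randomSet p : OracleAlg M N _) f = multilinear p f := by
  rw [randomSet, expect_bind]
  simp only [expect_pure]
  rw [expect_tabulate_filter (fun j => flip (p j)) (fun _ b => b = true) f]
  congr 1
  funext j
  simp [expect_flip (h0 j) (h1 j)]

theorem expect_pipageFrom {c : Fin M → ℝ} (hc : ∀ i, 0 ≤ c i) (i : Fin M) (l : List (Fin M))
    (a : Fin M) {p : ℝ} (hp : 0 ≤ p) (h1 : p + (l.map c).sum ≤ 1) :
    expect what (pipageFrom (N := N) c l a p) (fun r => if r = some i then 1 else 0) =
      (if a = i then p else 0) + (l.map fun b => if b = i then c b else 0).sum := by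
  induction l generalizing a p with
  | nil =>
    have hp1 : p ≤ 1 := by simpa using h1
    unfold pipageFrom
    rw [expect_bind, expect_flip hp hp1]
    by_cases ha : a = i <;> simp [ha]
  | cons b l ih =>
    have hb := hc b
    have h1' : p + c b + (l.map c).sum ≤ 1 := by simpa [add_assoc] using h1
    -- If `p + c b = 0`, the quotient has the default value 0, and the identity survives because
    -- then `p = 0`.
    have hq : p / (p + c b) * (p + c b) = p := by
      rcases (add_nonneg hp hb).eq_or_lt with h | h
      · rw [← h, mul_zero]; linarith
      · exact div_mul_cancel₀ _ h.ne'
    have hq0 : 0 ≤ p / (p + c b) := div_nonneg hp (add_nonneg hp hb)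
    have hq1 : p / (p + c b) ≤ 1 := div_le_one_of_le₀ (by linarith) (add_nonneg hp hb)
    unfold pipageFrom
    rw [expect_bind, expect_flip hq0 hq1]
    simp only [if_true, Bool.false_eq_true, if_false, ih _ (add_nonneg hp hb) h1',
      List.map_cons, List.sum_cons]
    set s := (l.map fun b => if b = i then c b else 0).sum
    set t := p / (p + c b)
    have hr : (1 - t) * (p + c b) = c b := by linear_combination -hq
    by_cases hi : b = i
    · subst hi
      by_cases ha : a = b <;> simp only [ha, if_true, if_false] <;> linarith
    · by_cases ha : a = i <;> simp only [ha, hi, if_true, if_false] <;> linarith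

theorem expect_pipageColumn {c : Fin M → ℝ} (hc : ∀ i, 0 ≤ c i) (h1 : ∑ i, c i ≤ 1)
    (i : Fin M) :
    expect what (pipageColumn (N := N) c) (fun r => if r = some i then 1 else 0) = c i := by
  have e : ∀ f : Fin M → ℝ, ∑ i, f i = ((List.finRange M).map f).sum := fun f => by
    rw [← List.ofFn_eq_map, List.sum_ofFn]
  unfold pipageColumn
  split
  · rename_i h
    exact absurd (List.mem_finRange i) (by simp [h])
  · rename_i a l h
    rw [e, h, List.map_cons, List.sum_cons] at h1
    rw [expect_pipageFrom hc i l a (hc a) h1]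
    have h2 := e fun b => if b = i then c b else 0
    rw [h, List.map_cons, List.sum_cons] at h2
    rw [← h2]
    simp

/-- The sum of the multilinear extensions of the valuations. -/
def fractionalWelfare (w : Fin M → Finset (Fin N) → ℝ) (y : Fin M → Fin N → ℝ) : ℝ :=
  ∑ i, multilinear (y i) (w i)

/-- Equality holds because the bundle of a single agent contains the items independently with
probabilities `y i j`. The correlation between agents within a column is invisible to a sum over
agents. -/
theorem expect_pipage (w : Fin M → Finset (Fin N) → ℝ) {y : Fin M → Fin N → ℝ}
    (h0 : ∀ i j, 0 ≤ y i j) (h1 : ∀ j, ∑ i, y i j ≤ 1) :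
    expect what (pipage y) (welfare w) = fractionalWelfare w y := by
  unfold pipage welfare fractionalWelfare
  rw [expect_bind]
  simp only [expect_pure, expect_sum]
  refine Finset.sum_congr rfl fun i _ => ?_
  simp only [bundle, Finset.mem_filter, Finset.mem_univ, true_and]
  rw [expect_tabulate_filter (fun j => pipageColumn fun i => y i j) (fun _ r => r = some i) (w i)]
  congr 1
  funext j
  exact expect_pipageColumn (fun i => h0 i j) (h1 j) i

end SubmodularWelfare
end

noncomputable section
namespace SubmodularWelfare
open OracleAlg

variable {M N : ℕ}

/-! ### Submodular valuations and expected marginals -/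

namespace IsValuation

variable {w : Finset (Fin N) → ℝ} (hw : IsValuation w)
include hw

theorem monotone : Monotone w := fun s t h => hw.mono s t h

theorem nonneg (s : Finset (Fin N)) : 0 ≤ w s := hw.empty ▸ hw.mono ∅ s (Finset.empty_subset s)

theorem sub_nonneg (j : Fin N) (s : Finset (Fin N)) : 0 ≤ w (insert j s) - w s :=
  _root_.sub_nonneg.2 (hw.mono _ _ (Finset.subset_insert j s))

theorem antitone_sub (j : Fin N) : Antitone fun s => w (insert j s) - w s := by
  intro s t hst
  by_cases hj : j ∈ t
  · have := hw.sub_nonneg j s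
    simpa [Finset.insert_eq_of_mem hj] using this
  · have h := hw.submodular (insert j s) t
    rw [Finset.insert_union, Finset.union_eq_right.2 hst, Finset.insert_inter_of_notMem hj,
      Finset.inter_eq_left.2 hst] at h
    simp only
    linarith

theorem sub_le_singleton (j : Fin N) (s : Finset (Fin N)) : w (insert j s) - w s ≤ w {j} := by
  have h := hw.antitone_sub j (Finset.empty_subset s)
  simpa [hw.empty] using h

theorem union_le (s t : Finset (Fin N)) :
    w (s ∪ t) ≤ w s + ∑ j ∈ t, (w (insert j s) - w s) := by
  induction t using Finset.induction_on with
  | empty => simp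
  | insert k t hk ih =>
    rw [Finset.sum_insert hk, Finset.union_insert]
    have h := hw.antitone_sub k (Finset.subset_union_left (s₁ := s) (s₂ := t))
    simp only at h
    linarith

end IsValuation

/-- The expected marginal value of `j` on top of a random set with marginals `p`. -/
def marginal (w : Finset (Fin N) → ℝ) (p : Fin N → ℝ) (j : Fin N) : ℝ :=
  multilinear p fun R => w (insert j R) - w R

section

variable {w : Finset (Fin N) → ℝ} (hw : IsValuation w) {p q : Fin N → ℝ}
include hw

theorem marginal_nonneg (h0 : ∀ j, 0 ≤ p j) (h1 : ∀ j, p j ≤ 1) (j : Fin N) :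
    0 ≤ marginal w p j :=
  multilinear_nonneg h0 h1 fun R => hw.sub_nonneg j R

theorem marginal_le_of_le (h0 : ∀ j, 0 ≤ p j) (h1 : ∀ j, q j ≤ 1) (hpq : ∀ j, p j ≤ q j)
    (j : Fin N) : marginal w q j ≤ marginal w p j :=
  multilinear_ge_of_le h0 h1 hpq (hw.antitone_sub j)

theorem le_multilinear_add_sum_marginal (h0 : ∀ j, 0 ≤ p j) (h1 : ∀ j, p j ≤ 1)
    (O : Finset (Fin N)) : w O ≤ multilinear p w + ∑ j ∈ O, marginal w p j := by
  simp only [marginal]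
  rw [← multilinear_sum, ← multilinear_add, ← multilinear_const p (w O)]
  exact multilinear_mono h0 h1 fun S =>
    (hw.mono _ _ Finset.subset_union_right).trans (hw.union_le S O)

variable {u : Fin N → ℝ} {m : ℝ}

/-- With probability `1 - u k ≥ 1 - m` the extra attempt to insert `k` does nothing, and otherwise
the marginal is still nonnegative. Each element of `J` therefore costs a factor `1 - m`, and
Bernoulli's inequality collects these factors. -/
theorem marginal_piecewise_ge (h0 : ∀ j, 0 ≤ p j) (h1 : ∀ j, p j ≤ 1) (hu0 : ∀ j, 0 ≤ u j)
    (hum : ∀ j, u j ≤ m) (hm : m ≤ 1) (J : Finset (Fin N)) (j : Fin N) :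
    (1 - J.card * m) * marginal w p j ≤
      marginal w (J.piecewise (fun k => p k + u k * (1 - p k)) p) j := by
  have hω := marginal_nonneg hw h0 h1 j
  induction J using Finset.induction_on with
  | empty => simp
  | insert k J hk ih =>
    set r := J.piecewise (fun k => p k + u k * (1 - p k)) p with hr
    have hr0 : ∀ i, 0 ≤ r i := fun i => by
      have := mul_nonneg (hu0 i) (sub_nonneg.2 (h1 i))
      by_cases hi : i ∈ J <;> simp [hr, hi, h0 i]
      linarith [h0 i]
    have hr1 : ∀ i, r i ≤ 1 := fun i => by
      have := mul_nonneg (sub_nonneg.2 ((hum i).trans hm)) (sub_nonneg.2 (h1 i))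
      by_cases hi : i ∈ J <;> simp [hr, hi, h1 i]
      linarith
    have hrk : r k = p k := by simp [hr, hk]
    have e : (insert k J).piecewise (fun k => p k + u k * (1 - p k)) p =
        Function.update r k (r k + u k * (1 - r k)) := by
      rw [Finset.piecewise_insert, hrk]
    have hn : 0 ≤ multilinear r fun S => w (insert j (insert k S)) - w (insert k S) :=
      multilinear_nonneg hr0 hr1 fun S => hw.sub_nonneg j _
    have hn' := marginal_nonneg hw hr0 hr1 j
    have hs : marginal w (Function.update r k (r k + u k * (1 - r k))) j =
        (1 - u k) * marginal w r j +
          u k * multilinear r fun S => w (insert j (insert k S)) - w (insert k S) := by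
      simp only [marginal, multilinear_update_add]
    rw [e, hs, Finset.card_insert_of_notMem hk]
    push_cast
    have h2 : (1 - m) * marginal w r j ≤ (1 - u k) * marginal w r j :=
      mul_le_mul_of_nonneg_right (by linarith [hum k]) hn'
    have h3 : (1 - m) * ((1 - J.card * m) * marginal w p j) ≤ (1 - m) * marginal w r j :=
      mul_le_mul_of_nonneg_left ih (by linarith)
    have h4 : 0 ≤ (J.card : ℝ) * m ^ 2 * marginal w p j := by positivity
    have h5 := mul_nonneg (hu0 k) hn
    nlinarith

/-- Inserting in a fixed order would charge the last element `(|J| - 1) m`. Averaging over the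
choice of the last element spreads the charge evenly and halves it. -/
theorem multilinear_piecewise_ge (h0 : ∀ j, 0 ≤ p j) (h1 : ∀ j, p j ≤ 1) (hu0 : ∀ j, 0 ≤ u j)
    (hum : ∀ j, u j ≤ m) (hm : m ≤ 1) (J : Finset (Fin N)) :
    multilinear p w + (1 - (J.card - 1) * m / 2) * ∑ j ∈ J, u j * marginal w p j ≤
      multilinear (J.piecewise (fun k => p k + u k * (1 - p k)) p) w := by
  induction hn : J.card generalizing J with
  | zero =>
    obtain rfl := Finset.card_eq_zero.1 hn
    simp
  | succ n ih =>
    set V := ∑ j ∈ J, u j * marginal w p j with hV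
    -- Here `k` is inserted last, after the `n` other elements. In the sum over `k` the coefficient
    -- of `V` is (1 - (n-1)m/2)n + (1 - nm) = (n+1)(1 - nm/2).
    have step : ∀ k ∈ J, multilinear p w + (1 - ((n : ℝ) - 1) * m / 2) *
          (V - u k * marginal w p k) + (1 - n * m) * (u k * marginal w p k) ≤
        multilinear (J.piecewise (fun k => p k + u k * (1 - p k)) p) w := by
      intro k hk
      have hc : (J.erase k).card = n := by rw [Finset.card_erase_of_mem hk, hn]; rfl
      have h := ih (J.erase k) hc
      have hsum : ∑ j ∈ J.erase k, u j * marginal w p j = V - u k * marginal w p k := by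
        rw [hV, ← Finset.add_sum_erase J _ hk]; ring
      have h2 := marginal_piecewise_ge hw h0 h1 hu0 hum hm (J.erase k) k
      rw [hsum] at h
      rw [hc] at h2
      set r := (J.erase k).piecewise (fun k => p k + u k * (1 - p k)) p with hr
      have hrk : r k = p k := by simp [hr]
      have e : J.piecewise (fun k => p k + u k * (1 - p k)) p =
          Function.update r k (r k + u k * (1 - r k)) := by
        rw [hrk, hr, ← Finset.piecewise_insert, Finset.insert_erase hk]
      have hs : multilinear r (fun S => w (insert k S)) = marginal w r k + multilinear r w := by
        rw [marginal, multilinear_sub]; ring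
      rw [e, multilinear_update_add, hs]
      have h3 := mul_le_mul_of_nonneg_left h2 (hu0 k)
      linarith
    have h := Finset.sum_le_sum step
    simp only [Finset.sum_add_distrib, Finset.sum_const, ← Finset.mul_sum,
      Finset.sum_sub_distrib, ← hV, hn, nsmul_eq_mul] at h
    push_cast at h ⊢
    have hpos : (0 : ℝ) < n + 1 := by positivity
    refine le_of_mul_le_mul_left ?_ hpos
    linarith

theorem multilinear_add_le (h0 : ∀ j, 0 ≤ p j) (h1 : ∀ j, p j ≤ 1) (hq1 : ∀ j, q j ≤ 1)
    (hu0 : ∀ j, 0 ≤ u j)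
    (hum : ∀ j, u j ≤ m) (hm : m ≤ 1) (hq : ∀ j, p j + u j * (1 - p j) ≤ q j) :
    multilinear p w + (1 - (N - 1) * m / 2) * ∑ j, u j * marginal w p j ≤ multilinear q w := by
  have h := multilinear_piecewise_ge hw h0 h1 hu0 hum hm Finset.univ
  simp only [Finset.card_univ, Fintype.card_fin, Finset.piecewise_univ] at h
  refine h.trans (multilinear_le_of_le (fun j => ?_) hq1 hq hw.monotone)
  have := mul_nonneg (hu0 j) (sub_nonneg.2 (h1 j))
  linarith [h0 j]

end

/-! ### The optimum -/

variable {w : Fin M → Finset (Fin N) → ℝ}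

theorem welfare_le_optWelfare {S : Finset (Fin M × Fin N)} (hS : Feasible S) :
    welfare w S ≤ optWelfare w := by
  classical
  exact Finset.le_sup' (welfare w) (by simpa using hS)

theorem optWelfare_le {c : ℝ} (h : ∀ S, Feasible S → welfare w S ≤ c) : optWelfare w ≤ c := by
  classical
  exact Finset.sup'_le _ _ fun S hS => h S (by simpa using hS)

theorem optWelfare_nonneg (hw : ∀ i, IsValuation (w i)) : 0 ≤ optWelfare w := by
  refine le_trans ?_ (welfare_le_optWelfare (w := w) (feasible_empty))
  exact Finset.sum_nonneg fun i _ => (hw i).nonneg _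

theorem singleton_le_optWelfare (hw : ∀ i, IsValuation (w i)) (i : Fin M) (j : Fin N) :
    w i {j} ≤ optWelfare w := by
  have hf : Feasible ({(i, j)} : Finset (Fin M × Fin N)) := by
    intro k
    refine Finset.card_le_one.2 fun a ha b hb => ?_
    simp only [Finset.mem_filter, Finset.mem_singleton, Prod.mk.injEq] at ha hb
    exact ha.2.1.trans hb.2.1.symm
  refine le_trans ?_ (welfare_le_optWelfare hf)
  refine le_trans ?_ (Finset.single_le_sum (f := fun i' => w i' (bundle {(i, j)} i'))
    (fun i' _ => (hw i').nonneg _) (Finset.mem_univ i))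
  refine (hw i).mono _ _ fun k hk => ?_
  rw [Finset.mem_singleton] at hk
  simp [bundle, hk]

/-- The largest expected marginal value of `j` to an agent. -/
def bestMarginal [NeZero M] (w : Fin M → Finset (Fin N) → ℝ) (y : Fin M → Fin N → ℝ)
    (j : Fin N) : ℝ :=
  Finset.univ.sup' Finset.univ_nonempty fun i => marginal (w i) (y i) j

section

variable [NeZero M] {y y' : Fin M → Fin N → ℝ}

theorem marginal_le_bestMarginal (i : Fin M) (j : Fin N) :
    marginal (w i) (y i) j ≤ bestMarginal w y j :=
  Finset.le_sup' (fun i => marginal (w i) (y i) j) (Finset.mem_univ i)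

theorem exists_marginal_eq_bestMarginal (w : Fin M → Finset (Fin N) → ℝ)
    (y : Fin M → Fin N → ℝ) (j : Fin N) :
    ∃ i, bestMarginal w y j = marginal (w i) (y i) j := by
  obtain ⟨i, -, hi⟩ := Finset.exists_mem_eq_sup' Finset.univ_nonempty
    fun i => marginal (w i) (y i) j
  exact ⟨i, hi⟩

variable (hw : ∀ i, IsValuation (w i)) (h0 : ∀ i j, 0 ≤ y i j)
include hw h0

theorem bestMarginal_nonneg (h1 : ∀ i j, y i j ≤ 1) (j : Fin N) : 0 ≤ bestMarginal w y j :=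
  (marginal_nonneg (hw 0) (h0 0) (h1 0) j).trans (marginal_le_bestMarginal 0 j)

theorem bestMarginal_le_of_le (h1 : ∀ i j, y' i j ≤ 1) (h : ∀ i j, y i j ≤ y' i j)
    (j : Fin N) : bestMarginal w y' j ≤ bestMarginal w y j := by
  obtain ⟨i, hi⟩ := exists_marginal_eq_bestMarginal w y' j
  rw [hi]
  exact (marginal_le_of_le (hw i) (h0 i) (h1 i) (h i) j).trans (marginal_le_bestMarginal i j)

/-- Add a feasible `S` on top of the random sets. By submodularity the increase is at most a sum of
single marginals, and feasibility charges each item at most once. -/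
theorem optWelfare_le_add_bestMarginal (h1 : ∀ i j, y i j ≤ 1) :
    optWelfare w ≤ fractionalWelfare w y + ∑ j, bestMarginal w y j := by
  refine optWelfare_le fun S hS => ?_
  have h : welfare w S ≤
      ∑ i, (multilinear (y i) (w i) + ∑ j ∈ bundle S i, marginal (w i) (y i) j) :=
    Finset.sum_le_sum fun i _ =>
      le_multilinear_add_sum_marginal (hw i) (h0 i) (h1 i) (bundle S i)
  refine h.trans ?_
  rw [Finset.sum_add_distrib]
  refine add_le_add le_rfl ?_
  have e : ∀ i, ∑ j ∈ bundle S i, marginal (w i) (y i) j =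
      ∑ j, if (i, j) ∈ S then marginal (w i) (y i) j else 0 := fun i => by
    rw [bundle, Finset.sum_filter]
  simp only [e]
  rw [Finset.sum_comm]
  refine Finset.sum_le_sum fun j _ => ?_
  rw [← Finset.sum_filter]
  refine (Finset.sum_le_card_nsmul _ _ (bestMarginal w y j)
    fun i _ => marginal_le_bestMarginal i j).trans ?_
  rw [nsmul_eq_mul]
  have hc : ((Finset.univ.filter fun i : Fin M => (i, j) ∈ S).card : ℝ) ≤ 1 := by
    exact_mod_cast hS j
  have := bestMarginal_nonneg hw h0 h1 j
  nlinarith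

end

end SubmodularWelfare
end

noncomputable section
namespace SubmodularWelfare
open OracleAlg

/-! ### The error of choosing agents by noisy samples -/

variable {M N : ℕ} {α : Type} {what : Fin M → Finset (Fin N) → ℝ}

namespace OracleAlg

theorem expect_tabulate_of_expect_eq {n : ℕ} (g : Fin n → OracleAlg M N α) (v : Fin n → α)
    (h : ∀ k (f : α → ℝ), expect what (g k) f = f (v k)) (f : (Fin n → α) → ℝ) :
    expect what (tabulate n g) f = f v := by
  rw [expect_tabulate_map g (fun _ => (pure () : OracleAlg M N Unit)) (fun k _ => v k)
    fun k f => by rw [h, expect_pure]]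
  exact expect_const _ _

end OracleAlg

/-- The marginal value of `j` to agent `i` on top of `R` according to the oracle. -/
def oracleMarginal (what : Fin M → Finset (Fin N) → ℝ) (i : Fin M) (R : Finset (Fin N))
    (j : Fin N) : ℝ :=
  if j ∈ R then 0 else what i (insert j R) - if R = ∅ then 0 else what i R

/-- The random sets that one step of continuous greedy draws. -/
def draws (Z : ℕ) (y : Fin M → Fin N → ℝ) :
    OracleAlg M N (Fin M → Fin Z → Finset (Fin N)) :=
  tabulate M fun i => tabulate Z fun _ => randomSet (y i)

/-- The agent for whom one step of continuous greedy raises the coordinate of `j`. -/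
def chosen (what : Fin M → Finset (Fin N) → ℝ) (pick : (Fin M → ℝ) → Fin M) {Z : ℕ}
    (x : Fin M → Fin Z → Finset (Fin N)) (j : Fin N) : Fin M :=
  pick fun i => (∑ z, oracleMarginal what i (x i z) j) / (Z : ℝ)

/-- The point `y` with the coordinates `(c j, j)` raised by `l`. -/
def raise (l : ℝ) (y : Fin M → Fin N → ℝ) (c : Fin N → Fin M) (i : Fin M) (j : Fin N) : ℝ :=
  if i = c j then y i j + l else y i j

theorem expect_value (i : Fin M) (s : Finset (Fin N)) (f : ℝ → ℝ) :
    expect what (value i s) f = f (if s = ∅ then 0 else what i s) := by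
  unfold value
  split_ifs <;> rfl

theorem expect_sampleMarginals (i : Fin M) (p : Fin N → ℝ) (f : (Fin N → ℝ) → ℝ) :
    expect what (sampleMarginals i p) f =
      expect what (randomSet p) fun R => f (oracleMarginal what i R) := by
  unfold sampleMarginals
  rw [expect_bind]
  congr 1
  funext R
  rw [expect_bind, expect_value]
  refine expect_tabulate_of_expect_eq _ _ (fun j f => ?_) f
  unfold oracleMarginal
  split_ifs <;> rfl

theorem expect_estimateMarginals (Z : ℕ) (i : Fin M) (p : Fin N → ℝ) (f : (Fin N → ℝ) → ℝ) :
    expect what (estimateMarginals Z i p) f =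
      expect what (tabulate Z fun _ => randomSet p) fun x =>
        f fun j => (∑ z, oracleMarginal what i (x z) j) / (Z : ℝ) := by
  unfold estimateMarginals
  rw [expect_bind, expect_tabulate_map _ _ (fun _ => oracleMarginal what i)
    fun _ f => expect_sampleMarginals i p f]
  rfl

theorem expect_greedyStep (pick : (Fin M → ℝ) → Fin M) (l : ℝ) (Z : ℕ) (y : Fin M → Fin N → ℝ)
    (f : (Fin M → Fin N → ℝ) → ℝ) :
    expect what (greedyStep pick l Z y) f =
      expect what (draws Z y) fun x => f (raise l y (chosen what pick x)) := by
  unfold greedyStep draws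
  rw [expect_bind, expect_tabulate_map _ _
    (fun i (x : Fin Z → Finset (Fin N)) j => (∑ z, oracleMarginal what i (x z) j) / (Z : ℝ))
    fun i f => expect_estimateMarginals Z i (y i) f]
  rfl

/-- Deviations from the mean sum to 0, so the one at `c` is minus the sum of the other `M - 1`.
Cauchy–Schwarz on those gives the factor `1 - 1/M`. -/
theorem sq_sub_mean_le (d : Fin M → ℝ) (c : Fin M) :
    (d c - (∑ i, d i) / M) ^ 2 ≤ (1 - 1 / (M : ℝ)) * (∑ i, d i ^ 2 - (∑ i, d i) ^ 2 / M) := by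
  have hM : (0 : ℝ) < M := by exact_mod_cast c.pos
  set m := (∑ i, d i) / M with hm
  have hs : ∑ i, d i = M * m := by rw [hm]; field_simp
  have h0 : ∑ i, (d i - m) = 0 := by simp [Finset.sum_sub_distrib, hs]
  have h2 : ∑ i, (d i - m) ^ 2 = ∑ i, d i ^ 2 - (∑ i, d i) ^ 2 / M := by
    simp only [sub_sq, Finset.sum_add_distrib, Finset.sum_sub_distrib, ← Finset.sum_mul,
      ← Finset.mul_sum, hs]
    simp
    field_simp
    ring
  rw [← Finset.add_sum_erase _ _ (Finset.mem_univ c)] at h0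
  have h3 := sq_sum_le_card_mul_sum_sq (s := Finset.univ.erase c) (f := fun i => d i - m)
  rw [Finset.card_erase_of_mem (Finset.mem_univ c), Finset.card_univ, Fintype.card_fin,
    Nat.cast_sub c.pos, eq_neg_of_add_eq_zero_right h0, neg_sq, Nat.cast_one] at h3
  rw [← h2, ← Finset.add_sum_erase _ _ (Finset.mem_univ c)]
  refine le_of_mul_le_mul_left ?_ hM
  rw [← mul_assoc, mul_sub, mul_one, mul_one_div_cancel hM.ne']
  linarith

/-- The expected value of one of `M` independent centred random variables, chosen in dependence
of their values. -/
theorem expect_chosen_le (g : Fin M → OracleAlg M N α) (d : Fin M → α → ℝ)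
    (h0 : ∀ i, expect what (g i) (d i) = 0) {s : ℝ} (hs : 0 ≤ s)
    (h2 : ∀ i, (expect what (g i) fun a => d i a ^ 2) ≤ s ^ 2) (c : (Fin M → α) → Fin M) :
    (expect what (tabulate M g) fun x => d (c x) (x (c x))) ≤
      (1 - 1 / (M : ℝ)) * (√M * s) := by
  rcases Nat.eq_zero_or_pos M with rfl | hM
  · exact (c (fun k => k.elim0)).elim0
  have hM' : (1 : ℝ) ≤ M := by exact_mod_cast hM
  have hq : 0 ≤ 1 - 1 / (M : ℝ) := by
    rw [sub_nonneg, div_le_one (by linarith)]; exact hM'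
  set A := tabulate M g
  have hmean : (expect what A fun x => (∑ i, d i (x i)) / M) = 0 := by
    simp only [div_eq_mul_inv, expect_mul_const, expect_sum]
    rw [Finset.sum_eq_zero fun i _ => (expect_tabulate_apply g i (d i)).trans (h0 i), zero_mul]
  have hvar : (expect what A fun x => ∑ i, d i (x i) ^ 2 - (∑ i, d i (x i)) ^ 2 / M) ≤
      (1 - 1 / (M : ℝ)) * (M * s ^ 2) := by
    have e1 : (expect what A fun x => ∑ i, d i (x i) ^ 2) =
        ∑ i, expect what (g i) fun a => d i a ^ 2 := by
      rw [expect_sum]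
      exact Finset.sum_congr rfl fun i _ => expect_tabulate_apply g i fun a => d i a ^ 2
    have e2 := expect_tabulate_sq_sum (what := what) g d h0
    simp only [expect_sub, div_eq_mul_inv, expect_mul_const]
    rw [e1, e2]
    have h3 : ∑ i, (expect what (g i) fun a => d i a ^ 2) ≤ M * s ^ 2 := by
      refine (Finset.sum_le_sum fun i _ => h2 i).trans ?_
      simp
    have := mul_le_mul_of_nonneg_left h3 hq
    simp only [one_div] at this ⊢
    linarith
  -- Subtracting the mean is free because its expectation is 0. The factor `1 - 1/M` enters twice,
  -- once pointwise from `sq_sub_mean_le` and once from `hvar`, so it leaves the square root intact.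
  have hsq : (expect what A fun x => d (c x) (x (c x)) - (∑ i, d i (x i)) / M) ^ 2 ≤
      ((1 - 1 / (M : ℝ)) * (√M * s)) ^ 2 := by
    refine (sq_expect_le A _).trans ((expect_mono A fun x =>
      sq_sub_mean_le (fun i => d i (x i)) (c x)).trans ?_)
    rw [expect_const_mul, mul_pow, mul_pow, Real.sq_sqrt (by linarith), sq, mul_assoc]
    exact mul_le_mul_of_nonneg_left hvar hq
  have h := (le_abs_self _).trans (abs_le_of_sq_le_sq hsq (by positivity))
  rwa [expect_sub, hmean, sub_zero] at h

section

variable {w : Fin M → Finset (Fin N) → ℝ} {ε : ℝ} {Z : ℕ}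
  (hw : ∀ i, IsValuation (w i)) (hε : ∀ i s, |what i s - w i s| ≤ ε)
include hw hε

theorem abs_oracleMarginal_sub_le (i : Fin M) (R : Finset (Fin N)) (j : Fin N) :
    |oracleMarginal what i R j - (w i (insert j R) - w i R)| ≤ 2 * ε := by
  have h1 := abs_le.1 (hε i (insert j R))
  have h2 := abs_le.1 (hε i R)
  have h0 : 0 ≤ ε := (abs_nonneg _).trans (hε i R)
  unfold oracleMarginal
  split_ifs with hj hR
  · rw [Finset.insert_eq_of_mem hj, sub_self, sub_self, abs_zero]; linarith
  · subst hR
    rw [(hw i).empty, abs_le]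
    constructor <;> linarith
  · rw [abs_le]
    constructor <;> linarith

theorem average_le_average_chosen {pick : (Fin M → ℝ) → Fin M}
    (hpick : ∀ (v : Fin M → ℝ) (i : Fin M), v i ≤ v (pick v)) (hZ : 0 < Z)
    (x : Fin M → Fin Z → Finset (Fin N)) (j : Fin N) (i : Fin M) :
    (∑ z, (w i (insert j (x i z)) - w i (x i z))) / (Z : ℝ) ≤
      (∑ z, (w (chosen what pick x j) (insert j (x (chosen what pick x j) z)) -
        w (chosen what pick x j) (x (chosen what pick x j) z))) / (Z : ℝ) + 4 * ε := by
  have hZ' : (0 : ℝ) < Z := by exact_mod_cast hZ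
  have key : ∀ i, |(∑ z, oracleMarginal what i (x i z) j) / (Z : ℝ) -
      (∑ z, (w i (insert j (x i z)) - w i (x i z))) / (Z : ℝ)| ≤ 2 * ε := by
    intro i
    rw [← sub_div, ← Finset.sum_sub_distrib, abs_div, abs_of_pos hZ', div_le_iff₀ hZ']
    refine (Finset.abs_sum_le_sum_abs _ _).trans ?_
    refine (Finset.sum_le_sum fun z _ => abs_oracleMarginal_sub_le hw hε i (x i z) j).trans ?_
    simp [mul_comm]
  have h := hpick (fun i => (∑ z, oracleMarginal what i (x i z) j) / (Z : ℝ)) i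
  have h1 := abs_le.1 (key i)
  have h2 := abs_le.1 (key (chosen what pick x j))
  unfold chosen at h2 ⊢
  linarith

-- A variable with values in `[0, W]` satisfies `a ^ 2 ≤ W * a`, so its variance is at most `m (W -
-- m) ≤ (W / 2) ^ 2`. The range bound holds because a singleton is worth at most the optimum.
omit hε in
theorem expect_randomSet_sq_sub_le {p : Fin N → ℝ} (h0 : ∀ j, 0 ≤ p j) (h1 : ∀ j, p j ≤ 1)
    (i : Fin M) (j : Fin N) :
    (expect what (randomSet p) fun R => (w i (insert j R) - w i R - marginal (w i) p j) ^ 2) ≤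
      (optWelfare w / 2) ^ 2 := by
  rw [expect_randomSet h0 h1]
  set m := marginal (w i) p j with hm
  set W := optWelfare w
  have h : multilinear p (fun R => (w i (insert j R) - w i R - m) ^ 2) ≤
      multilinear p fun R => (W - 2 * m) * (w i (insert j R) - w i R) + m ^ 2 := by
    refine multilinear_mono h0 h1 fun R => ?_
    have ha := (hw i).sub_nonneg j R
    have hb := ((hw i).sub_le_singleton j R).trans (singleton_le_optWelfare hw i j)
    nlinarith
  rw [multilinear_add, multilinear_const_mul, multilinear_const] at h
  refine h.trans ?_
  change (W - 2 * m) * m + m ^ 2 ≤ _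
  nlinarith [sq_nonneg (W / 2 - m)]

/-- The expected loss from choosing agents by estimates instead of by true marginal values. -/
theorem expect_bestMarginal_sub_le [NeZero M] {pick : (Fin M → ℝ) → Fin M}
    (hpick : ∀ (v : Fin M → ℝ) (i : Fin M), v i ≤ v (pick v)) (hZ : 0 < Z)
    {y : Fin M → Fin N → ℝ} (h0 : ∀ i j, 0 ≤ y i j) (h1 : ∀ i j, y i j ≤ 1) (j : Fin N) :
    (expect what (draws Z y) fun x => bestMarginal w y j -
        marginal (w (chosen what pick x j)) (y (chosen what pick x j)) j) ≤
      4 * ε + (1 - 1 / (M : ℝ)) * (√M * (optWelfare w / (2 * √Z))) := by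
  have hZ' : (0 : ℝ) < Z := by exact_mod_cast hZ
  set ω : Fin M → ℝ := fun i => marginal (w i) (y i) j with hω
  set d : Fin M → (Fin Z → Finset (Fin N)) → ℝ :=
    fun i x => ∑ z, (w i (insert j (x z)) - w i (x z) - ω i) / (Z : ℝ) with hd
  have hdω : ∀ i x, (∑ z, (w i (insert j (x z)) - w i (x z))) / (Z : ℝ) = d i x + ω i := by
    intro i x
    simp only [hd, ← Finset.sum_div, Finset.sum_sub_distrib]
    simp
    field_simp
    ring
  have hz0 : ∀ i, (expect what (randomSet (y i) : OracleAlg M N _) fun R =>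
      (w i (insert j R) - w i R - ω i) / (Z : ℝ)) = 0 := by
    intro i
    simp only [div_eq_mul_inv, expect_mul_const, expect_sub, expect_const]
    rw [← expect_sub, expect_randomSet (h0 i) (h1 i)]
    change (ω i - ω i) * _ = 0
    simp
  have hd0 : ∀ i, expect what (tabulate Z fun _ => randomSet (y i)) (d i) = 0 := by
    intro i
    simp only [hd]
    rw [expect_sum]
    refine Finset.sum_eq_zero fun z _ => ?_
    rw [expect_tabulate_apply (fun _ : Fin Z => (randomSet (y i) : OracleAlg M N _)) z
      fun R => (w i (insert j R) - w i R - ω i) / (Z : ℝ)]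
    exact hz0 i
  have hd2 : ∀ i, (expect what (tabulate Z fun _ => randomSet (y i)) fun x => d i x ^ 2) ≤
      (optWelfare w / (2 * √Z)) ^ 2 := by
    intro i
    rw [expect_tabulate_sq_sum _
      (fun _ R => (w i (insert j R) - w i R - ω i) / (Z : ℝ)) fun _ => hz0 i]
    have h := expect_randomSet_sq_sub_le (what := what) hw (h0 i) (h1 i) i j
    simp only [div_pow, div_eq_mul_inv _ ((Z : ℝ) ^ 2), expect_mul_const]
    rw [Finset.sum_const, Finset.card_univ, Fintype.card_fin, nsmul_eq_mul, ← mul_assoc,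
      ← div_eq_mul_inv, mul_pow, Real.sq_sqrt hZ'.le, div_le_div_iff₀ (by positivity)
      (by positivity)]
    calc _ ≤ (Z : ℝ) * (optWelfare w / 2) ^ 2 * (2 ^ 2 * Z) := by gcongr
      _ = _ := by ring
  obtain ⟨o, ho⟩ := exists_marginal_eq_bestMarginal w y j
  -- The best agent `o` does not depend on the samples, so `d o` averages to 0; only the deviation
  -- of the chosen agent can be biased. Each oracle average is off by at most 2ε, which gives 4ε for
  -- the comparison.
  have hpath : ∀ x : Fin M → Fin Z → Finset (Fin N),
      bestMarginal w y j - marginal (w (chosen what pick x j)) (y (chosen what pick x j)) j ≤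
        d (chosen what pick x j) (x (chosen what pick x j)) - d o (x o) + 4 * ε := by
    intro x
    have h := average_le_average_chosen hw hε hpick hZ x j o
    rw [hdω, hdω] at h
    rw [ho]
    simp only [hω] at h ⊢
    linarith
  refine (expect_mono _ hpath).trans ?_
  rw [expect_add, expect_sub, expect_const]
  have h3 := expect_chosen_le (what := what) (fun i => tabulate Z fun _ => randomSet (y i)) d hd0
    (div_nonneg (optWelfare_nonneg hw) (by positivity)) hd2 fun x => chosen what pick x j
  have h4 := (expect_tabulate_apply (what := what)
    (fun i => tabulate Z fun _ => randomSet (y i)) o (d o)).trans (hd0 o)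
  unfold draws
  linarith

end

end SubmodularWelfare
end

noncomputable section
namespace SubmodularWelfare
open OracleAlg

variable {M N : ℕ} {what : Fin M → Finset (Fin N) → ℝ}

/-! ### The points that continuous greedy visits -/

/-- All coordinates of `y` are multiples of `1 / K`, and every column has sum `k / K`. -/
def IsGrid (K k : ℕ) (y : Fin M → Fin N → ℝ) : Prop :=
  ∃ n : Fin M → Fin N → ℕ, (∀ i j, y i j = n i j / (K : ℝ)) ∧ ∀ j, ∑ i, n i j = k

theorem isGrid_zero (K : ℕ) : IsGrid K 0 (0 : Fin M → Fin N → ℝ) :=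
  ⟨fun _ _ => 0, by simp, by simp⟩

namespace IsGrid

variable {K k : ℕ} {y : Fin M → Fin N → ℝ} (h : IsGrid K k y)
include h

theorem nonneg (i : Fin M) (j : Fin N) : 0 ≤ y i j := by
  obtain ⟨n, hn, -⟩ := h
  rw [hn]
  positivity

theorem sum_eq (j : Fin N) : ∑ i, y i j = k / (K : ℝ) := by
  obtain ⟨n, hn, hs⟩ := h
  simp only [hn, ← Finset.sum_div, ← hs j]
  push_cast
  rfl

theorem le_div (i : Fin M) (j : Fin N) : y i j ≤ k / (K : ℝ) :=
  h.sum_eq j ▸ Finset.single_le_sum (f := fun i => y i j) (fun i _ => h.nonneg i j)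
    (Finset.mem_univ i)

theorem le_one (hk : k ≤ K) (i : Fin M) (j : Fin N) : y i j ≤ 1 :=
  (h.le_div i j).trans (div_le_one_of_le₀ (by exact_mod_cast hk) (by positivity))

theorem raise (c : Fin N → Fin M) :
    IsGrid K (k + 1) (SubmodularWelfare.raise (1 / (K : ℝ)) y c) := by
  obtain ⟨n, hn, hs⟩ := h
  refine ⟨fun i j => n i j + if i = c j then 1 else 0, fun i j => ?_, fun j => ?_⟩
  · unfold SubmodularWelfare.raise
    by_cases hi : i = c j <;> simp [hi, hn]
    ring
  · simp [Finset.sum_add_distrib, hs]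

end IsGrid

theorem le_raise {l : ℝ} (hl : 0 ≤ l) (y : Fin M → Fin N → ℝ) (c : Fin N → Fin M) (i : Fin M)
    (j : Fin N) : y i j ≤ raise l y c i j := by
  unfold raise
  split_ifs <;> linarith

theorem always_greedyStep (pick : (Fin M → ℝ) → Fin M) (l : ℝ) (Z : ℕ)
    (y : Fin M → Fin N → ℝ) :
    Always what (fun y' => ∃ c, y' = raise l y c) (greedyStep pick l Z y) :=
  always_bind (P := fun _ => True) (Always.of_forall (fun _ => trivial) _)
    fun ω _ => ⟨fun j => pick fun i' => ω i' j, rfl⟩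

theorem always_isGrid_greedySteps (pick : (Fin M → ℝ) → Fin M) (K Z n : ℕ) {k : ℕ}
    {y : Fin M → Fin N → ℝ} (h : IsGrid K k y) :
    Always what (IsGrid K (k + n)) (greedySteps pick (1 / (K : ℝ)) Z n y) := by
  induction n generalizing k y with
  | zero => exact h
  | succ n ih =>
    refine always_bind (always_greedyStep pick (1 / (K : ℝ)) Z y) ?_
    rintro _ ⟨c, rfl⟩
    rw [← Nat.add_assoc, Nat.add_right_comm]
    exact ih (h.raise c)

/-- The definition peels off the first step, whereas the recursion for the welfare needs the last
one. -/
theorem expect_greedySteps_succ (pick : (Fin M → ℝ) → Fin M) (l : ℝ) (Z n : ℕ)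
    (y : Fin M → Fin N → ℝ) (f : (Fin M → Fin N → ℝ) → ℝ) :
    expect what (greedySteps pick l Z (n + 1) y) f =
      expect what (greedySteps pick l Z n y) fun y' => expect what (greedyStep pick l Z y') f := by
  induction n generalizing y with
  | zero =>
    simp only [greedySteps, expect_bind, expect_pure]
  | succ n ih =>
    rw [greedySteps, expect_bind]
    simp only [ih]
    rw [greedySteps, expect_bind]

/-- The expectation of `f` at the point after `k` steps. -/
def stepExpect (what : Fin M → Finset (Fin N) → ℝ) (pick : (Fin M → ℝ) → Fin M) (K Z k : ℕ)
    (f : (Fin M → Fin N → ℝ) → ℝ) : ℝ :=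
  expect what (greedySteps pick (1 / (K : ℝ)) Z k 0) f

section

variable {pick : (Fin M → ℝ) → Fin M} {K Z k : ℕ} {f g : (Fin M → Fin N → ℝ) → ℝ}

theorem stepExpect_zero : stepExpect what pick K Z 0 f = f 0 := rfl

theorem stepExpect_succ : stepExpect what pick K Z (k + 1) f =
    stepExpect what pick K Z k fun y =>
      expect what (draws Z y) fun x => f (raise (1 / (K : ℝ)) y (chosen what pick x)) := by
  simp only [stepExpect, expect_greedySteps_succ, expect_greedyStep]

theorem stepExpect_mono (h : ∀ y, IsGrid K k y → f y ≤ g y) :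
    stepExpect what pick K Z k f ≤ stepExpect what pick K Z k g := by
  refine expect_mono_of_always ((always_isGrid_greedySteps pick K Z k (isGrid_zero K)).imp ?_)
  intro y hy
  rw [zero_add] at hy
  exact h y hy

theorem expectedWelfare_continuousGreedy (w : Fin M → Finset (Fin N) → ℝ) :
    expectedWelfare w what (continuousGreedy pick K Z) =
      stepExpect what pick K Z K (fractionalWelfare w) := by
  unfold expectedWelfare
  rw [sum_law_mul, continuousGreedy, expect_bind, stepExpect]
  refine expect_congr_of_always ((always_isGrid_greedySteps pick K Z K (isGrid_zero K)).imp ?_)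
  intro y hy
  rw [zero_add] at hy
  refine expect_pipage w hy.nonneg fun j => ?_
  rw [hy.sum_eq]
  exact div_self_le_one _

end

theorem fractionalWelfare_zero {w : Fin M → Finset (Fin N) → ℝ} (hw : ∀ i, IsValuation (w i)) :
    fractionalWelfare w 0 = 0 := by
  refine Finset.sum_eq_zero fun i _ => ?_
  unfold multilinear
  refine Finset.sum_eq_zero fun S _ => ?_
  rcases S.eq_empty_or_nonempty with rfl | ⟨j, hj⟩
  · rw [(hw i).empty, mul_zero]
  · rw [Finset.prod_eq_zero (Finset.mem_univ j) (by simp [hj]), zero_mul]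

theorem expect_draws_average {Z : ℕ} (w : Fin M → Finset (Fin N) → ℝ) (hZ : 0 < Z)
    {y : Fin M → Fin N → ℝ} (h0 : ∀ i j, 0 ≤ y i j) (h1 : ∀ i j, y i j ≤ 1) (o : Fin M)
    (j : Fin N) :
    (expect what (draws Z y) fun x => (∑ z, (w o (insert j (x o z)) - w o (x o z))) / (Z : ℝ)) =
      marginal (w o) (y o) j := by
  have hZ' : (Z : ℝ) ≠ 0 := by positivity
  simp only [div_eq_mul_inv, expect_mul_const, expect_sum]
  have e : ∀ z : Fin Z, (expect what (draws Z y) fun x =>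
      w o (insert j (x o z)) - w o (x o z)) = marginal (w o) (y o) j := by
    intro z
    unfold draws
    rw [expect_tabulate_apply (fun i => tabulate Z fun _ => randomSet (y i)) o
        fun a => w o (insert j (a z)) - w o (a z),
      expect_tabulate_apply (fun _ : Fin Z => (randomSet (y o) : OracleAlg M N _)) z
        fun R => w o (insert j R) - w o R, expect_randomSet (h0 o) (h1 o)]
    rfl
  simp only [e]
  simp
  field_simp

/-! ### A single agent -/

/-- Every step raises all coordinates of the only agent, so `y` ends at the all-ones point whatever
the oracle says. -/
theorem optWelfare_le_stepExpect_of_single_agent {N K Z : ℕ}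
    {what w : Fin 1 → Finset (Fin N) → ℝ} (hw : ∀ i, IsValuation (w i))
    (pick : (Fin 1 → ℝ) → Fin 1) (hK : 0 < K) :
    optWelfare w ≤ stepExpect what pick K Z K (fractionalWelfare w) := by
  refine optWelfare_le fun S _ => ?_
  have h : welfare w S ≤ stepExpect what pick K Z K fun _ => welfare w S := by
    simp [stepExpect]
  refine h.trans (stepExpect_mono fun y hy => ?_)
  have hy1 : y 0 = fun _ => 1 := by
    funext j
    have := hy.sum_eq j
    rw [div_self (by positivity)] at this
    simpa using this
  simp only [welfare, fractionalWelfare, Finset.univ_unique, Finset.sum_singleton]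
  change w 0 _ ≤ multilinear (y 0) (w 0)
  rw [hy1, multilinear_one]
  exact (hw 0).monotone (Finset.subset_univ _)

/-! ### A single item -/

theorem multilinear_fin_one (p : Fin 1 → ℝ) (f : Finset (Fin 1) → ℝ) :
    multilinear p f = (1 - p 0) * f ∅ + p 0 * f {0} := by
  rw [multilinear_eq_sum_erase p f 0]
  simp

section

variable {M K Z k : ℕ} [NeZero M] {what w : Fin M → Finset (Fin 1) → ℝ} {ε : ℝ}
  {pick : (Fin M → ℝ) → Fin M}

/-- For one item the multilinear extension is affine, so the step size costs nothing. Selection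
costs nothing either: every sampled marginal of the chosen agent is at most its exact gain `w (c 0)
{0}`, and the average of the fixed best agent is unbiased. Only the noise 4ε remains. -/
theorem stepExpect_succ_single_item (hw : ∀ i, IsValuation (w i))
    (hε : ∀ i s, |what i s - w i s| ≤ ε)
    (hpick : ∀ (v : Fin M → ℝ) (i : Fin M), v i ≤ v (pick v)) (hZ : 0 < Z) (hk : k ≤ K) :
    stepExpect what pick K Z k (fractionalWelfare w) + 1 / (K : ℝ) *
        (optWelfare w - 4 * ε - stepExpect what pick K Z k (fractionalWelfare w)) ≤
      stepExpect what pick K Z (k + 1) (fractionalWelfare w) := by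
  have e : stepExpect what pick K Z k (fractionalWelfare w) + 1 / (K : ℝ) *
        (optWelfare w - 4 * ε - stepExpect what pick K Z k (fractionalWelfare w)) =
      stepExpect what pick K Z k fun y => fractionalWelfare w y + 1 / (K : ℝ) *
        (optWelfare w - 4 * ε - fractionalWelfare w y) := by
    simp only [stepExpect, expect_add, expect_const_mul, expect_sub, expect_const]
  rw [e, stepExpect_succ]
  refine stepExpect_mono fun y hy => ?_
  have h0 := hy.nonneg
  have h1 := hy.le_one hk
  obtain ⟨o, ho⟩ := exists_marginal_eq_bestMarginal w y 0
  have hopt := optWelfare_le_add_bestMarginal hw h0 h1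
  rw [Finset.univ_unique, Finset.sum_singleton] at hopt
  change _ ≤ _ + bestMarginal w y 0 at hopt
  rw [ho, ← expect_draws_average (what := what) w hZ h0 h1] at hopt
  have hpath : ∀ x : Fin M → Fin Z → Finset (Fin 1),
      fractionalWelfare w y + 1 / (K : ℝ) *
        ((∑ z, (w o (insert 0 (x o z)) - w o (x o z))) / (Z : ℝ) - 4 * ε) ≤
      fractionalWelfare w (raise (1 / (K : ℝ)) y (chosen what pick x)) := by
    intro x
    set c := chosen what pick x with hc
    have hf : fractionalWelfare w (raise (1 / (K : ℝ)) y c) =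
        fractionalWelfare w y + 1 / (K : ℝ) * w (c 0) {0} := by
      have : ∀ i, multilinear (raise (1 / (K : ℝ)) y c i) (w i) = multilinear (y i) (w i) +
          if i = c 0 then 1 / (K : ℝ) * w i {0} else 0 := by
        intro i
        rw [multilinear_fin_one, multilinear_fin_one, (hw i).empty]
        unfold raise
        split_ifs <;> ring
      simp only [fractionalWelfare, this, Finset.sum_add_distrib, Finset.sum_ite_eq',
        Finset.mem_univ, if_true]
    rw [hf]
    have h2 := average_le_average_chosen hw hε hpick hZ x 0 o
    rw [← hc] at h2
    have h3 : (∑ z, (w (c 0) (insert 0 (x (c 0) z)) - w (c 0) (x (c 0) z))) / (Z : ℝ) ≤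
        w (c 0) {0} := by
      rw [div_le_iff₀ (by exact_mod_cast hZ)]
      refine (Finset.sum_le_sum fun z _ => (hw (c 0)).sub_le_singleton 0 _).trans ?_
      simp [mul_comm]
    have h4 : (0 : ℝ) ≤ 1 / (K : ℝ) := by positivity
    have h5 := mul_le_mul_of_nonneg_left (h2.trans (add_le_add_left h3 _)) h4
    linarith
  refine le_trans ?_ (expect_mono _ hpath)
  rw [expect_add, expect_const_mul, expect_sub, expect_const, expect_const]
  have h4 : (0 : ℝ) ≤ 1 / (K : ℝ) := by positivity
  have h5 := mul_le_mul_of_nonneg_left hopt h4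
  linarith

theorem one_sub_one_div_pow_le {K : ℕ} (hK : 0 < K) :
    (1 - 1 / (K : ℝ)) ^ K ≤ 1 / Real.exp 1 := by
  have h := Real.one_sub_div_pow_le_exp_neg (n := K) (t := 1) (by exact_mod_cast hK)
  rwa [Real.exp_neg, ← one_div] at h

theorem stepExpect_ge_single_item (hw : ∀ i, IsValuation (w i))
    (hε : ∀ i s, |what i s - w i s| ≤ ε)
    (hpick : ∀ (v : Fin M → ℝ) (i : Fin M), v i ≤ v (pick v)) (hZ : 0 < Z) (hK : 0 < K) :
    (1 - 1 / Real.exp 1) * optWelfare w - 4 * ε ≤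
      stepExpect what pick K Z K (fractionalWelfare w) := by
  have hK' : (1 : ℝ) ≤ K := by exact_mod_cast hK
  have hr : 0 ≤ 1 - 1 / (K : ℝ) := by
    rw [sub_nonneg, div_le_one (by linarith)]; exact hK'
  have hε0 : 0 ≤ ε := (abs_nonneg _).trans (hε 0 ∅)
  have H : ∀ k ≤ K, optWelfare w - 4 * ε - stepExpect what pick K Z k (fractionalWelfare w) ≤
      (1 - 1 / (K : ℝ)) ^ k * (optWelfare w - 4 * ε) := by
    intro k
    induction k with
    | zero => simp [stepExpect_zero, fractionalWelfare_zero hw]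
    | succ k ih =>
      intro hk
      have h1 := stepExpect_succ_single_item (Z := Z) hw hε hpick hZ (Nat.le_of_succ_le hk)
      have h2 := mul_le_mul_of_nonneg_left (ih (Nat.le_of_succ_le hk)) hr
      rw [pow_succ']
      linarith
  have h1 := H K le_rfl
  have h2 := mul_le_mul_of_nonneg_right (one_sub_one_div_pow_le hK) (optWelfare_nonneg hw)
  have h3 : 0 ≤ (1 - 1 / (K : ℝ)) ^ K * (4 * ε) := mul_nonneg (pow_nonneg hr _) (by linarith)
  linarith

end

end SubmodularWelfare
end

noncomputable section
namespace SubmodularWelfare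
open OracleAlg

variable {M N : ℕ}

/-! ### The gain from raising coordinates that are already positive -/

/-- The part of a coordinate `t` that counts towards the gain. -/
def bonus (M : ℕ) (t : ℝ) : ℝ := min t (1 / (M : ℝ))

/-- The sum of the bonuses over the steps that have raised a coordinate `n` times. -/
def bonusSum (M K n : ℕ) : ℝ := ∑ l ∈ Finset.range n, bonus M (l / (K : ℝ))

/-- The average bonus per item in the `k`-th step, if the steps are spread evenly. -/
def evenBonus (M K k : ℕ) : ℝ := ((k / M : ℕ) : ℝ) / (K : ℝ)

theorem bonus_nonneg {t : ℝ} (ht : 0 ≤ t) : 0 ≤ bonus M t := le_min ht (by positivity)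

theorem evenBonus_nonneg (M K k : ℕ) : 0 ≤ evenBonus M K k := by
  unfold evenBonus; positivity

theorem two_mul_sum_range_div (M k : ℕ) :
    2 * ∑ l ∈ Finset.range k, l / M + M * ((k / M) * (k / M + 1)) = 2 * (k / M) * k := by
  induction k with
  | zero => simp
  | succ k ih =>
    rw [Finset.sum_range_succ, Nat.succ_div]
    split_ifs with h
    · have hk : M * (k / M + 1) = k + 1 := by
        have := Nat.mul_div_cancel' h
        rwa [Nat.succ_div, if_pos h] at this
      generalize k / M = q at *
      generalize ∑ l ∈ Finset.range k, l / M = s at *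
      zify at *
      linear_combination ih + 2 * hk
    · simp only [add_zero]
      linarith

/-- As a function of `n`, the sum of `min l q` is convex and has slope `q` from `n = q` on. The
bound is that line, with equality for every `n ≥ q`, so it is exact for an even spread with all
counts `q` or `q + 1`. -/
theorem two_mul_sum_range_min_ge (n q : ℕ) :
    2 * q * n ≤ 2 * ∑ l ∈ Finset.range n, min l q + q * (q + 1) := by
  rcases le_total n q with h | h
  · have e : ∑ l ∈ Finset.range n, min l q = ∑ l ∈ Finset.range n, l :=
      Finset.sum_congr rfl fun l hl => min_eq_left ((Finset.mem_range.1 hl).le.trans h)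
    have h2 := Finset.sum_range_id_mul_two n
    rw [e]
    obtain ⟨d, rfl⟩ := Nat.exists_eq_add_of_le h
    rcases n with _ | n
    · simp
    · simp only [Nat.add_sub_cancel] at h2
      nlinarith
  · induction n, h using Nat.le_induction with
    | base =>
      have e : ∑ l ∈ Finset.range q, min l q = ∑ l ∈ Finset.range q, l :=
        Finset.sum_congr rfl fun l hl => min_eq_left (Finset.mem_range.1 hl).le
      have h2 := Finset.sum_range_id_mul_two q
      rw [e]
      rcases q with _ | q
      · simp
      · simp only [Nat.add_sub_cancel] at h2
        nlinarith
    | succ n hn ih =>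
      rw [Finset.sum_range_succ, min_eq_right hn]
      linarith

theorem sum_evenBonus_le {K k : ℕ} (hK : 0 < K) (hM : 0 < M) (hk : k ≤ K) (n : Fin M → ℕ)
    (hn : ∑ i, n i = k) :
    ∑ l ∈ Finset.range k, evenBonus M K l ≤ ∑ i, bonusSum M K (n i) := by
  have hK' : (0 : ℝ) < K := by exact_mod_cast hK
  have hM' : (0 : ℝ) < M := by exact_mod_cast hM
  set q := k / M with hq
  -- Truncating the counts at `q` stays below the cap `1 / M` in `bonus`, because `k ≤ K`.
  have hqM : (q : ℝ) / K ≤ 1 / M := by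
    rw [div_le_div_iff₀ hK' hM', one_mul]
    exact_mod_cast (Nat.div_mul_le_self k M).trans hk
  have h1 : ∀ i, (2 * q * n i - q * (q + 1)) / (2 * (K : ℝ)) ≤ bonusSum M K (n i) := by
    intro i
    have h : (2 * q * n i : ℝ) ≤ 2 * ∑ l ∈ Finset.range (n i), ((min l q : ℕ) : ℝ) + q * (q + 1) := by
      exact_mod_cast two_mul_sum_range_min_ge (n i) q
    have h2 : (∑ l ∈ Finset.range (n i), ((min l q : ℕ) : ℝ)) / K ≤ bonusSum M K (n i) := by
      rw [Finset.sum_div]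
      refine Finset.sum_le_sum fun l _ => le_min ?_ (le_trans ?_ hqM)
      · gcongr; exact min_le_left l q
      · gcongr; exact min_le_right l q
    refine le_trans ?_ h2
    rw [div_le_div_iff₀ (by positivity) hK']
    nlinarith
  have h3 := Finset.sum_le_sum fun i (_ : i ∈ Finset.univ) => h1 i
  refine le_trans (le_of_eq ?_) h3
  have h4 : (2 * ∑ l ∈ Finset.range k, ((l / M : ℕ) : ℝ) + M * (q * (q + 1)) : ℝ) = 2 * q * k := by
    exact_mod_cast two_mul_sum_range_div M k
  have h5 : ∑ i, (n i : ℝ) = k := by exact_mod_cast hn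
  simp only [evenBonus]
  rw [← Finset.sum_div, ← Finset.sum_div, Finset.sum_sub_distrib, ← Finset.mul_sum, h5]
  simp only [Finset.sum_const, Finset.card_univ, Fintype.card_fin, nsmul_eq_mul]
  field_simp
  linarith

/-- The bonus that the column `j` of `y` has collected in excess of the even one. -/
def excess (K k : ℕ) (y : Fin M → Fin N → ℝ) (j : Fin N) : ℝ :=
  ∑ i, bonusSum M K ⌊y i j * K⌋₊ - ∑ l ∈ Finset.range k, evenBonus M K l

section

variable {K k : ℕ} {y : Fin M → Fin N → ℝ}

theorem excess_nonneg (hK : 0 < K) (hM : 0 < M) (hk : k ≤ K) (h : IsGrid K k y) (j : Fin N) :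
    0 ≤ excess K k y j := by
  obtain ⟨n, hn, hs⟩ := h
  have hK' : (K : ℝ) ≠ 0 := by positivity
  have h := sum_evenBonus_le hK hM hk (fun i => n i j) (hs j)
  simp only [excess, hn, div_mul_cancel₀ _ hK', Nat.floor_natCast]
  linarith

theorem excess_raise (hK : 0 < K) (h : IsGrid K k y) (c : Fin N → Fin M) (j : Fin N) :
    excess K (k + 1) (raise (1 / (K : ℝ)) y c) j =
      excess K k y j + bonus M (y (c j) j) - evenBonus M K k := by
  obtain ⟨n, hn, hs⟩ := h
  have hK' : (K : ℝ) ≠ 0 := by positivity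
  -- On the grid the floor recovers the number of times a coordinate was raised. The bonus collected
  -- so far is thus a function of the current point, and no history is needed.
  have e : ∀ i, bonusSum M K ⌊raise (1 / (K : ℝ)) y c i j * K⌋₊ =
      bonusSum M K ⌊y i j * K⌋₊ + if i = c j then bonus M (y i j) else 0 := by
    intro i
    unfold raise
    rw [hn, div_mul_cancel₀ _ hK', Nat.floor_natCast]
    split_ifs
    · have : (n i j / (K : ℝ) + 1 / K) * K = ((n i j + 1 : ℕ) : ℝ) := by
        push_cast
        field_simp
      rw [this, Nat.floor_natCast, bonusSum, Finset.sum_range_succ, bonusSum]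
    · rw [div_mul_cancel₀ _ hK', Nat.floor_natCast, add_zero]
  simp only [excess, e, Finset.sum_add_distrib, Finset.sum_ite_eq', Finset.mem_univ, if_true,
    Finset.sum_range_succ]
  ring

end

/-! ### One step of continuous greedy -/

section

variable [NeZero M] {K Z k : ℕ} {what w : Fin M → Finset (Fin N) → ℝ} {ε : ℝ}
  {pick : (Fin M → ℝ) → Fin M} {y : Fin M → Fin N → ℝ}

/-- The expected bonus of one step from `y`. -/
def expectedBonus (what w : Fin M → Finset (Fin N) → ℝ) (pick : (Fin M → ℝ) → Fin M) (Z : ℕ)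
    (y : Fin M → Fin N → ℝ) : ℝ :=
  expect what (draws Z y) fun x =>
    ∑ j, bonus M (y (chosen what pick x j) j) * bestMarginal w y j

/-- A raise is treated as an independent attempt to insert `j` with probability `(1 + bonus) / K`.
The cap on the bonus keeps both the attempt probability and the weight of a wrong choice within a
factor `1 + 1/M`. -/
theorem le_fractionalWelfare_raise (hw : ∀ i, IsValuation (w i)) (hK : 0 < K)
    (hm : (1 + 1 / (M : ℝ)) / K ≤ 1)
    (hN : 0 ≤ 1 - ((N : ℝ) - 1) * ((1 + 1 / (M : ℝ)) / K) / 2) (hk : k + 1 ≤ K)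
    (hy : IsGrid K k y) (c : Fin N → Fin M) :
    fractionalWelfare w y + (1 - ((N : ℝ) - 1) * ((1 + 1 / (M : ℝ)) / K) / 2) / K *
        (∑ j, bestMarginal w y j + ∑ j, bonus M (y (c j) j) * bestMarginal w y j -
          (1 + 1 / (M : ℝ)) *
            ∑ j, (bestMarginal w y j - marginal (w (c j)) (y (c j)) j)) ≤
      fractionalWelfare w (raise (1 / (K : ℝ)) y c) := by
  have hK' : (0 : ℝ) < K := by exact_mod_cast hK
  have h0 := hy.nonneg
  have h1 := hy.le_one (Nat.le_of_succ_le hk)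
  have hr1 := (hy.raise c).le_one hk
  set m := (1 + 1 / (M : ℝ)) / K with hmdef
  set u : Fin M → Fin N → ℝ := fun i j => if i = c j then (1 + bonus M (y i j)) / K else 0 with hu
  have hb0 : ∀ i j, 0 ≤ bonus M (y i j) := fun i j => bonus_nonneg (h0 i j)
  have hu0 : ∀ i j, 0 ≤ u i j := fun i j => by
    have := hb0 i j
    simp only [hu]
    split_ifs
    · positivity
    · exact le_rfl
  have hum : ∀ i j, u i j ≤ m := fun i j => by
    simp only [hu, hmdef]
    split_ifs
    · gcongr
      exact min_le_right _ _
    · positivity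
  -- This is where the bonus is justified: `(1 + bonus)(1 - y) ≤ (1 + y)(1 - y) ≤ 1`.
  have hq : ∀ i j, y i j + u i j * (1 - y i j) ≤ raise (1 / (K : ℝ)) y c i j := fun i j => by
    simp only [hu, raise]
    split_ifs
    · have h2 : (1 + bonus M (y i j)) * (1 - y i j) ≤ 1 := by
        have h3 : bonus M (y i j) ≤ y i j := min_le_left _ _
        nlinarith [h0 i j, h1 i j, hb0 i j]
      rw [div_mul_eq_mul_div]
      gcongr
    · simp
  have hi : ∀ i, multilinear (y i) (w i) + (1 - ((N : ℝ) - 1) * m / 2) *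
      ∑ j, u i j * marginal (w i) (y i) j ≤ multilinear (raise (1 / (K : ℝ)) y c i) (w i) :=
    fun i => multilinear_add_le (hw i) (h0 i) (h1 i) (hr1 i) (hu0 i) (hum i) hm (hq i)
  have hs := Finset.sum_le_sum fun i (_ : i ∈ Finset.univ) => hi i
  rw [Finset.sum_add_distrib, ← Finset.mul_sum, Finset.sum_comm] at hs
  refine le_trans ?_ hs
  have hcol : ∀ j, ∑ i, u i j * marginal (w i) (y i) j =
      (1 + bonus M (y (c j) j)) * marginal (w (c j)) (y (c j)) j / K := fun j => by
    simp only [hu, ite_mul, zero_mul, Finset.sum_ite_eq', Finset.mem_univ, if_true]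
    ring
  simp only [hcol]
  rw [fractionalWelfare, ← Finset.sum_div, div_mul_eq_mul_div, mul_div_assoc]
  refine add_le_add_right (mul_le_mul_of_nonneg_left (div_le_div_of_nonneg_right ?_ hK'.le) hN) _
  rw [Finset.mul_sum, ← Finset.sum_add_distrib, ← Finset.sum_sub_distrib]
  refine Finset.sum_le_sum fun j _ => ?_
  have h2 : bonus M (y (c j) j) ≤ 1 / M := min_le_right _ _
  have h3 := marginal_le_bestMarginal (w := w) (y := y) (c j) j
  nlinarith

theorem le_expect_fractionalWelfare_raise (hw : ∀ i, IsValuation (w i))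
    (hε : ∀ i s, |what i s - w i s| ≤ ε)
    (hpick : ∀ (v : Fin M → ℝ) (i : Fin M), v i ≤ v (pick v)) (hZ : 0 < Z) (hK : 0 < K)
    (hm : (1 + 1 / (M : ℝ)) / K ≤ 1)
    (hN : 0 ≤ 1 - ((N : ℝ) - 1) * ((1 + 1 / (M : ℝ)) / K) / 2) (hk : k + 1 ≤ K)
    (hy : IsGrid K k y) :
    fractionalWelfare w y + (1 - ((N : ℝ) - 1) * ((1 + 1 / (M : ℝ)) / K) / 2) / K *
        (∑ j, bestMarginal w y j + expectedBonus what w pick Z y - (1 + 1 / (M : ℝ)) *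
          (N * (4 * ε + (1 - 1 / (M : ℝ)) * (√M * (optWelfare w / (2 * √Z)))))) ≤
      expect what (draws Z y) fun x =>
        fractionalWelfare w (raise (1 / (K : ℝ)) y (chosen what pick x)) := by
  refine le_trans ?_ (expect_mono _ fun x =>
    le_fractionalWelfare_raise hw hK hm hN hk hy (chosen what pick x))
  rw [expect_add, expect_const, expect_const_mul, expect_sub, expect_add, expect_const,
    expect_const_mul, expect_sum _ _ (fun j x => bestMarginal w y j -
      marginal (w (chosen what pick x j)) (y (chosen what pick x j)) j)]
  have h : ∑ j, (expect what (draws Z y) fun x => bestMarginal w y j -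
        marginal (w (chosen what pick x j)) (y (chosen what pick x j)) j) ≤
      N * (4 * ε + (1 - 1 / (M : ℝ)) * (√M * (optWelfare w / (2 * √Z)))) := by
    refine (Finset.sum_le_sum fun j _ => expect_bestMarginal_sub_le hw hε hpick hZ hy.nonneg
      (hy.le_one (Nat.le_of_succ_le hk)) j).trans ?_
    rw [Finset.sum_const, Finset.card_univ, Fintype.card_fin, nsmul_eq_mul]
  unfold expectedBonus
  gcongr

/-- One step of a summation by parts: best marginals decrease along the steps and the new excess is
nonnegative, so it may be weighted by the old marginals. -/
theorem expect_excess_raise_le (hw : ∀ i, IsValuation (w i)) (hK : 0 < K) (hk : k + 1 ≤ K)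
    (hy : IsGrid K k y) :
    (expect what (draws Z y) fun x =>
        ∑ j, excess K (k + 1) (raise (1 / (K : ℝ)) y (chosen what pick x)) j *
          bestMarginal w (raise (1 / (K : ℝ)) y (chosen what pick x)) j) ≤
      ∑ j, excess K k y j * bestMarginal w y j + expectedBonus what w pick Z y -
        evenBonus M K k * ∑ j, bestMarginal w y j := by
  have hM : 0 < M := NeZero.pos M
  have h : ∀ c : Fin N → Fin M,
      ∑ j, excess K (k + 1) (raise (1 / (K : ℝ)) y c) j *
          bestMarginal w (raise (1 / (K : ℝ)) y c) j ≤
        ∑ j, excess K k y j * bestMarginal w y j +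
          ∑ j, bonus M (y (c j) j) * bestMarginal w y j -
          evenBonus M K k * ∑ j, bestMarginal w y j := by
    intro c
    rw [Finset.mul_sum, ← Finset.sum_add_distrib, ← Finset.sum_sub_distrib]
    refine Finset.sum_le_sum fun j _ => ?_
    have h1 := bestMarginal_le_of_le hw hy.nonneg ((hy.raise c).le_one hk)
      (le_raise (by positivity) y c) j
    have h2 := mul_le_mul_of_nonneg_left h1 (excess_nonneg hK hM hk (hy.raise c) j)
    have h3 := excess_raise hK hy c j
    refine h2.trans (le_of_eq ?_)
    rw [h3]
    ring
  refine (expect_mono _ fun x => h (chosen what pick x)).trans (le_of_eq ?_)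
  rw [expect_sub, expect_add, expect_const, expect_const]
  rfl

end

end SubmodularWelfare
end

noncomputable section
namespace SubmodularWelfare
open OracleAlg

/-! ### Solving the recursion -/

/-- `G` is the gap to the optimum, `B` the bonus and `S` the potential. Telescoping `S` gives Σ B ≥
Σ φ G. Since `G - L` contracts by at least `1 - l` per step, earlier gaps are bounded below through
the final one, so the bonus becomes a multiple of `G K - L` and moves to the left side. -/
theorem recursion_bound {K : ℕ} {l L : ℝ} (hl0 : 0 ≤ l) (hl1 : l ≤ 1) (hL : 0 ≤ L)
    {G Ω B S φ : ℕ → ℝ} (hG : ∀ k < K, G (k + 1) ≤ G k - l * (Ω k + B k - L))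
    (hΩ : ∀ k < K, G k ≤ Ω k) (hS : ∀ k < K, S (k + 1) ≤ S k + B k - φ k * Ω k)
    (hS0 : S 0 = 0) (hSK : 0 ≤ S K) (hB : ∀ k < K, 0 ≤ B k) (hφ : ∀ k, 0 ≤ φ k) :
    (G K - L) * (1 + l * ∑ k ∈ Finset.range K, φ k * (1 - l) ^ k) ≤ (1 - l) ^ K * (G 0 - L) := by
  have hr0 : 0 ≤ 1 - l := by linarith
  have hr1 : 1 - l ≤ 1 := by linarith
  have hstep : ∀ k < K, G (k + 1) - L ≤ (1 - l) * (G k - L) - l * B k := fun k hk => by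
    have := mul_le_mul_of_nonneg_left (hΩ k hk) hl0
    linarith [hG k hk]
  have hup : ∀ n ≤ K, G n - L ≤ (1 - l) ^ n * (G 0 - L - l * ∑ k ∈ Finset.range n, B k) := by
    intro n
    induction n with
    | zero => simp
    | succ n ih =>
      intro hn
      have h1 := mul_le_mul_of_nonneg_left (ih (Nat.le_of_succ_le hn)) hr0
      -- The new bonus is weakened to carry the same discount as the older ones, so that only the
      -- plain sum of the bonuses enters.
      have h2 : (1 - l) ^ (n + 1) * (l * B n) ≤ l * B n :=
        mul_le_of_le_one_left (mul_nonneg hl0 (hB n hn)) (pow_le_one₀ hr0 hr1)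
      have h3 := hstep n hn
      rw [Finset.sum_range_succ]
      rw [pow_succ'] at h2 ⊢
      linarith
  have hdown : ∀ n k, k + n = K → G K - L ≤ (1 - l) ^ n * (G k - L) := by
    intro n
    induction n with
    | zero => rintro k rfl; simp
    | succ n ih =>
      intro k hk
      have h1 := ih (k + 1) (by omega)
      have hkK : k < K := by omega
      have h2 := hstep k hkK
      have h3 := mul_nonneg hl0 (hB k hkK)
      have h4 := mul_le_mul_of_nonneg_left (h2.trans (sub_le_self _ h3)) (pow_nonneg hr0 n)
      rw [pow_succ]
      linarith
  have hSn : ∀ n ≤ K, S n ≤ ∑ k ∈ Finset.range n, (B k - φ k * G k) := by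
    intro n
    induction n with
    | zero => simp [hS0]
    | succ n ih =>
      intro hn
      have h1 := ih (Nat.le_of_succ_le hn)
      have h2 := hS n hn
      have h3 := mul_le_mul_of_nonneg_left (hΩ n hn) (hφ n)
      rw [Finset.sum_range_succ]
      linarith
  have h1 : ∑ k ∈ Finset.range K, φ k * G k ≤ ∑ k ∈ Finset.range K, B k := by
    have := hSK.trans (hSn K le_rfl)
    rw [Finset.sum_sub_distrib] at this
    linarith
  have h2 : (G K - L) * ∑ k ∈ Finset.range K, φ k * (1 - l) ^ k ≤
      (1 - l) ^ K * ∑ k ∈ Finset.range K, φ k * G k := by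
    rw [Finset.mul_sum, Finset.mul_sum]
    refine Finset.sum_le_sum fun k hk => ?_
    have hkK := (Finset.mem_range.1 hk).le
    have h3 := hdown (K - k) k (by omega)
    have h4 := mul_le_mul_of_nonneg_left h3 (pow_nonneg hr0 k)
    rw [← mul_assoc, ← pow_add, Nat.add_sub_cancel' hkK] at h4
    have h5 : (1 - l) ^ K * (G k - L) ≤ (1 - l) ^ K * G k :=
      mul_le_mul_of_nonneg_left (by linarith) (pow_nonneg hr0 K)
    have h6 := mul_le_mul_of_nonneg_left (h4.trans h5) (hφ k)
    linarith
  have h3 := mul_le_mul_of_nonneg_left h1 (pow_nonneg hr0 K)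
  have h4 := mul_le_mul_of_nonneg_left (h2.trans h3) hl0
  have h5 := hup K le_rfl
  linarith

/-! ### Numerical estimates -/

theorem one_div_exp_one_gt : (0.367879 : ℝ) < 1 / Real.exp 1 := by
  rw [lt_div_iff₀ (Real.exp_pos 1)]
  have := Real.exp_one_lt_d9
  linarith

theorem exp_neg_half_gt : (0.606 : ℝ) < Real.exp (-(1 / 2)) := by
  have h : Real.exp (-(1 / 2)) ^ 2 = 1 / Real.exp 1 := by
    rw [← Real.exp_nat_mul, one_div (Real.exp 1), ← Real.exp_neg]
    norm_num
  have h2 := one_div_exp_one_gt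
  have h3 := Real.exp_pos (-(1 / 2))
  nlinarith

/-- First `1 - 1/K ≥ exp (-1/(K-1))`; then the exponential is replaced by its tangent at 1/2, the
middle of the range of `k / (K - 1)`. A linear weight can be summed in closed form. -/
theorem exp_neg_div_le_pow {K : ℕ} (hK : 2 ≤ K) (k : ℕ) :
    Real.exp (-(1 / 2)) * (3 / 2 - k / ((K : ℝ) - 1)) ≤ (1 - 1 / (K : ℝ)) ^ k := by
  have hK' : (2 : ℝ) ≤ K := by exact_mod_cast hK
  have h1 : Real.exp (-(1 / ((K : ℝ) - 1))) ≤ 1 - 1 / (K : ℝ) := by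
    have h2 := Real.add_one_le_exp (1 / ((K : ℝ) - 1))
    have h3 : (1 - 1 / (K : ℝ)) = (1 / ((K : ℝ) - 1) + 1)⁻¹ := by
      have : (K : ℝ) - 1 ≠ 0 := by linarith
      have h0 : (K : ℝ) ≠ 0 := by linarith
      rw [div_add_one this, inv_div, add_sub_cancel, sub_div, div_self h0]
    have h4 : 0 < 1 / ((K : ℝ) - 1) := by
      have : (0 : ℝ) < K - 1 := by linarith
      positivity
    rw [Real.exp_neg, h3]
    exact inv_anti₀ (by linarith) h2
  refine le_trans ?_ (pow_le_pow_left₀ (Real.exp_nonneg _) h1 k)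
  rw [← Real.exp_nat_mul]
  have h5 : (k : ℝ) * -(1 / ((K : ℝ) - 1)) = -(1 / 2) + (1 / 2 - k / ((K : ℝ) - 1)) := by ring
  rw [h5, Real.exp_add]
  refine mul_le_mul_of_nonneg_left ?_ (Real.exp_nonneg _)
  have := Real.add_one_le_exp (1 / 2 - k / ((K : ℝ) - 1))
  linarith

theorem sum_range_weight (K : ℕ) (m : ℝ) (hK : (K : ℝ) - 1 ≠ 0) :
    ∑ k ∈ Finset.range K, ((k : ℝ) + 1 - m) * (3 / 2 - k / ((K : ℝ) - 1)) =
      K * ((5 * K - 7) / 12 - (m - 1)) := by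
  have h1 : ∀ n : ℕ, ∑ k ∈ Finset.range n, (k : ℝ) = n * (n - 1) / 2 := by
    intro n
    induction n with
    | zero => simp
    | succ n ih => rw [Finset.sum_range_succ, ih]; push_cast; ring
  have h2 : ∀ n : ℕ, ∑ k ∈ Finset.range n, (k : ℝ) ^ 2 = n * (n - 1) * (2 * n - 1) / 6 := by
    intro n
    induction n with
    | zero => simp
    | succ n ih => rw [Finset.sum_range_succ, ih]; push_cast; ring
  have h3 : ∀ k : ℕ, ((k : ℝ) + 1 - m) * (3 / 2 - k / ((K : ℝ) - 1)) =
      3 / 2 * k + 3 / 2 * (1 - m) - (k : ℝ) ^ 2 * (1 / ((K : ℝ) - 1)) -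
        k * ((1 - m) * (1 / ((K : ℝ) - 1))) := fun k => by ring
  simp only [h3, Finset.sum_sub_distrib, Finset.sum_add_distrib, ← Finset.sum_mul,
    ← Finset.mul_sum, h1, h2, Finset.sum_const, Finset.card_range, nsmul_eq_mul]
  field_simp
  ring

theorem sum_evenBonus_mul_pow_ge {M K : ℕ} (hM : 0 < M) (hK : 2 ≤ K) {r : ℝ}
    (hr : 1 - 1 / (K : ℝ) ≤ r) (hg : 0 ≤ (5 * (K : ℝ) - 7) / 12 - (M - 1)) :
    0.606 * ((5 * (K : ℝ) - 7) / 12 - (M - 1)) / M ≤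
      ∑ k ∈ Finset.range K, evenBonus M K k * r ^ k := by
  have hK' : (2 : ℝ) ≤ K := by exact_mod_cast hK
  have hM' : (0 : ℝ) < M := by exact_mod_cast hM
  have hK1 : (K : ℝ) - 1 ≠ 0 := by linarith
  have hr0 : 0 ≤ 1 - 1 / (K : ℝ) := by
    rw [sub_nonneg, div_le_one (by linarith)]; linarith
  have h : ∀ k ∈ Finset.range K,
      Real.exp (-(1 / 2)) / (M * K) * (((k : ℝ) + 1 - M) * (3 / 2 - k / ((K : ℝ) - 1))) ≤
        evenBonus M K k * r ^ k := by
    intro k hk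
    have hkK : (k : ℝ) ≤ K - 1 := by
      have := Finset.mem_range.1 hk
      have : ((k + 1 : ℕ) : ℝ) ≤ K := by exact_mod_cast this
      push_cast at this
      linarith
    have h1 : 0 ≤ 3 / 2 - k / ((K : ℝ) - 1) := by
      have : k / ((K : ℝ) - 1) ≤ 1 := div_le_one_of_le₀ hkK (by linarith)
      linarith
    -- The floor satisfies `k / M ≥ (k + 1 - M) / M`.
    have h2 : ((k : ℝ) + 1 - M) / (M * K) ≤ evenBonus M K k := by
      have h3 : k + 1 ≤ (k / M + 1) * M := Nat.lt_div_mul_add hM |>.trans_eq (by ring)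
      have h4 : (k : ℝ) + 1 ≤ (((k / M : ℕ) : ℝ) + 1) * M := by exact_mod_cast h3
      unfold evenBonus
      rw [div_le_div_iff₀ (by positivity) (by linarith)]
      have : ((k : ℝ) + 1 - M) ≤ ((k / M : ℕ) : ℝ) * M := by linarith
      calc _ ≤ ((k / M : ℕ) : ℝ) * M * K := by gcongr
        _ = _ := by ring
    have h5 := (exp_neg_div_le_pow hK k).trans (pow_le_pow_left₀ hr0 hr k)
    calc _ = ((k : ℝ) + 1 - M) / (M * K) *
          (Real.exp (-(1 / 2)) * (3 / 2 - k / ((K : ℝ) - 1))) := by ring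
      _ ≤ evenBonus M K k * (Real.exp (-(1 / 2)) * (3 / 2 - k / ((K : ℝ) - 1))) :=
        mul_le_mul_of_nonneg_right h2 (mul_nonneg (Real.exp_nonneg _) h1)
      _ ≤ _ := mul_le_mul_of_nonneg_left h5 (evenBonus_nonneg M K k)
  refine le_trans ?_ (Finset.sum_le_sum h)
  rw [← Finset.mul_sum, sum_range_weight K M hK1]
  have h6 : Real.exp (-(1 / 2)) / (M * K) * (K * ((5 * (K : ℝ) - 7) / 12 - (M - 1))) =
      Real.exp (-(1 / 2)) * ((5 * (K : ℝ) - 7) / 12 - (M - 1)) / M := by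
    field_simp
  rw [h6]
  have := exp_neg_half_gt.le
  gcongr

/-- The gain from the bonuses outweighs the losses from the step size and from sampling. -/
def GainOutweighsLoss (M K : ℕ) (ρ s : ℝ) : Prop :=
  (1 - (1 - ρ) / K) ^ K * (1 - s) ≤ (1 / Real.exp 1 - s) *
    (1 + (1 - ρ) / K * ∑ k ∈ Finset.range K, evenBonus M K k * (1 - (1 - ρ) / K) ^ k)

/-- The smallest case, where `K = 16` is too small for the general estimate; the sum is evaluated
explicitly. -/
theorem gainOutweighsLoss_two_two {s : ℝ} (hs : s ≤ 0.03316) :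
    GainOutweighsLoss 2 16 (3 / 64) s := by
  unfold GainOutweighsLoss
  have he := one_div_exp_one_gt
  have h1 : ((1 - (1 - 3 / 64) / ((16 : ℕ) : ℝ)) : ℝ) ^ 16 ≤ 0.3744 := by norm_num
  have h2 : (0.085 : ℝ) ≤ (1 - 3 / 64) / ((16 : ℕ) : ℝ) *
      ∑ k ∈ Finset.range 16, evenBonus 2 16 k * (1 - (1 - 3 / 64) / ((16 : ℕ) : ℝ)) ^ k := by
    simp only [evenBonus, Finset.sum_range_succ, Finset.sum_range_zero]
    norm_num
  calc _ ≤ 0.3744 * (1 - s) := mul_le_mul_of_nonneg_right h1 (by linarith)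
    _ ≤ (0.367879 - s) * (1 + 0.085) := by linarith
    _ ≤ (1 / Real.exp 1 - s) * (1 + 0.085) := by gcongr
    _ ≤ _ := mul_le_mul_of_nonneg_left (by linarith) (by linarith)

/-- Relative to 1/e, the step loss costs about `ρ` and the sampling loss about `(e - 1) s`, against
a gain of at least `0.2 / M`. The threshold 0.16 leaves room for the products of small terms. -/
theorem gainOutweighsLoss_of_le {M K : ℕ} (hM : 2 ≤ M) (hK : 36 ≤ K)
    (hMK : 18 * ((M : ℝ) - 1) ≤ K) {ρ s : ℝ} (hρ0 : 0 ≤ ρ) (hρ : ρ ≤ 1 / 24) (hs0 : 0 ≤ s)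
    (hs : s ≤ 0.02) (hloss : (25 / 24 * ρ + 1.7183 * s) * M ≤ 0.16) :
    GainOutweighsLoss M K ρ s := by
  unfold GainOutweighsLoss
  have hK' : (36 : ℝ) ≤ K := by exact_mod_cast hK
  have hM' : (2 : ℝ) ≤ M := by exact_mod_cast hM
  -- The worst case is `K = 36` and `M - 1 = K / 18`: 5/12 - 7/432 - 1/18 > 0.3448.
  have hg : 0.3448 * (K : ℝ) ≤ (5 * (K : ℝ) - 7) / 12 - (M - 1) := by linarith
  have hr : 1 - 1 / (K : ℝ) ≤ 1 - (1 - ρ) / K := by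
    have : (1 - ρ) / (K : ℝ) ≤ 1 / K := by gcongr; linarith
    linarith
  have h1 := sum_evenBonus_mul_pow_ge (M := M) (by omega) (by omega) hr (by linarith)
  have h2 : 0.2 / (M : ℝ) ≤ (1 - ρ) / K *
      ∑ k ∈ Finset.range K, evenBonus M K k * (1 - (1 - ρ) / K) ^ k := by
    have h3 : 0.606 * (0.3448 * (K : ℝ)) / M ≤
        ∑ k ∈ Finset.range K, evenBonus M K k * (1 - (1 - ρ) / K) ^ k := by
      refine le_trans ?_ h1
      gcongr
    calc 0.2 / (M : ℝ) ≤ (23 / 24) / K * (0.606 * (0.3448 * (K : ℝ)) / M) := by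
          rw [div_mul_div_comm, div_le_div_iff₀ (by positivity) (by positivity)]
          nlinarith [mul_pos (by linarith : (0 : ℝ) < K) (by linarith : (0 : ℝ) < M)]
      _ ≤ (1 - ρ) / K * (0.606 * (0.3448 * (K : ℝ)) / M) := by gcongr; linarith
      _ ≤ _ := by
          refine mul_le_mul_of_nonneg_left h3 (div_nonneg (by linarith) (by linarith))
  generalize (1 - ρ) / (K : ℝ) *
    ∑ k ∈ Finset.range K, evenBonus M K k * (1 - (1 - ρ) / K) ^ k = Γ at h2 ⊢
  have hE := one_div_exp_one_gt
  set E := 1 / Real.exp 1 with hEdef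
  -- For `ρ ≤ 1/24`, `exp ρ ≤ 1 + ρ + ρ ^ 2 ≤ 1 + 25/24 ρ`.
  have h3 : (1 - (1 - ρ) / K) ^ K ≤ (1 + 25 / 24 * ρ) * E := by
    have h4 := Real.one_sub_div_pow_le_exp_neg (n := K) (t := 1 - ρ) (by linarith)
    have h5 := (abs_le.1 (Real.abs_exp_sub_one_sub_id_le (x := ρ)
      (by rw [abs_of_nonneg hρ0]; linarith))).2
    have h6 : Real.exp (-(1 - ρ)) = Real.exp ρ * E := by
      rw [hEdef, one_div, ← Real.exp_neg, ← Real.exp_add]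
      congr 1
      ring
    rw [h6] at h4
    refine h4.trans (mul_le_mul_of_nonneg_right ?_ (by linarith))
    nlinarith
  set v := 1 / (M : ℝ) with hv
  have hv0 : 0 ≤ v := by positivity
  have hΓ : 0.2 * v ≤ Γ := by rw [hv, mul_one_div]; exact h2
  have hloss' : 25 / 24 * ρ + 1.7183 * s ≤ 0.16 * v := by
    rw [hv, mul_one_div, le_div_iff₀ (by linarith)]
    exact hloss
  have hmain : (1 + 25 / 24 * ρ) * (1 - s) ≤ (1 - 2.7183 * s) * (1 + Γ) := by
    have h7 : (1 - 2.7183 * s) * (1 + 0.2 * v) ≤ (1 - 2.7183 * s) * (1 + Γ) :=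
      mul_le_mul_of_nonneg_left (by linarith) (by linarith)
    have h8 : 0 ≤ ρ * s := mul_nonneg hρ0 hs0
    have h9 : s * v ≤ 0.02 * v := mul_le_mul_of_nonneg_right hs hv0
    linarith
  have hEs : E * (1 - 2.7183 * s) ≤ E - s := by nlinarith
  calc _ ≤ (1 + 25 / 24 * ρ) * E * (1 - s) := mul_le_mul_of_nonneg_right h3 (by linarith)
    _ = E * ((1 + 25 / 24 * ρ) * (1 - s)) := by ring
    _ ≤ E * ((1 - 2.7183 * s) * (1 + Γ)) := mul_le_mul_of_nonneg_left hmain (by linarith)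
    _ = E * (1 - 2.7183 * s) * (1 + Γ) := by ring
    _ ≤ _ := mul_le_mul_of_nonneg_right hEs (by linarith)

/-- The relative loss from choosing agents by estimates. -/
def samplingLoss (M N : ℕ) : ℝ := (1 - 1 / (M : ℝ) ^ 2) / (2 * (M : ℝ) ^ 2 * N * √N)

/-- The relative loss from the size of the steps. -/
def stepLoss (M N : ℕ) : ℝ :=
  ((N : ℝ) - 1) * ((1 + 1 / (M : ℝ)) / (((M * N) ^ 2 : ℕ) : ℝ)) / 2

theorem gainOutweighsLoss {M N : ℕ} (hM : 2 ≤ M) (hN : 2 ≤ N) :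
    GainOutweighsLoss M ((M * N) ^ 2) (stepLoss M N) (samplingLoss M N) := by
  have hM' : (2 : ℝ) ≤ M := by exact_mod_cast hM
  have hN' : (2 : ℝ) ≤ N := by exact_mod_cast hN
  have hsq2 : (1.4142 : ℝ) ≤ √2 := Real.le_sqrt_of_sq_le (by norm_num)
  have hM1 : 1 / (M : ℝ) ≤ 1 / 2 := by gcongr
  have hMsq : 1 / (M : ℝ) ^ 2 ≤ 1 := by
    rw [div_le_one (by positivity)]; nlinarith
  have hs0 : 0 ≤ samplingLoss M N := div_nonneg (by linarith) (by positivity)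
  have hρ0 : 0 ≤ stepLoss M N := by
    unfold stepLoss
    have : (0 : ℝ) ≤ N - 1 := by linarith
    positivity
  -- Apart from `M = N = 2`, the product `M N` is at least 6, which gives `K ≥ 36`. For `M = 2` and
  -- `N ≥ 3` the bounds come from `N`; for `M ≥ 3` the losses are bounded after multiplication by
  -- `M`.
  rcases hM.eq_or_lt with rfl | hM3
  · rcases hN.eq_or_lt with rfl | hN3
    · have e : stepLoss 2 2 = 3 / 64 := by unfold stepLoss; norm_num
      rw [e]
      refine gainOutweighsLoss_two_two ?_
      unfold samplingLoss
      rw [div_le_iff₀ (by positivity)]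
      push_cast
      nlinarith
    · have hN3' : (3 : ℝ) ≤ N := by exact_mod_cast hN3
      have hsq3 : (1.732 : ℝ) ≤ √N := Real.le_sqrt_of_sq_le (by norm_num; linarith)
      have hNN : 3 * 1.732 ≤ (N : ℝ) * √N := mul_le_mul hN3' hsq3 (by norm_num) (by linarith)
      have hs : samplingLoss 2 N ≤ 0.0185 := by
        unfold samplingLoss
        rw [div_le_iff₀ (by positivity)]
        push_cast
        linarith
      have hρ : stepLoss 2 N ≤ 1 / 24 := by
        have e : stepLoss 2 N = 3 / 16 * (((N : ℝ) - 1) / (N : ℝ) ^ 2) := by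
          unfold stepLoss
          push_cast
          field_simp
          norm_num
          ring
        have h : ((N : ℝ) - 1) / (N : ℝ) ^ 2 ≤ 2 / 9 := by
          rw [div_le_div_iff₀ (by positivity) (by norm_num)]
          nlinarith
        rw [e]
        linarith
      refine gainOutweighsLoss_of_le le_rfl ?_ ?_ hρ0 hρ hs0 (hs.trans (by norm_num)) ?_
      · nlinarith
      · push_cast; nlinarith
      · push_cast; linarith
  · have hM3' : (3 : ℝ) ≤ M := by exact_mod_cast hM3
    have hsq : (1.4142 : ℝ) ≤ √N := hsq2.trans (Real.sqrt_le_sqrt hN')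
    have hNN : 2 * 1.4142 ≤ (N : ℝ) * √N := mul_le_mul hN' hsq (by norm_num) (by linarith)
    have hM13 : 1 / (M : ℝ) ≤ 1 / 3 := by gcongr
    have hsM : samplingLoss M N * M ≤ 0.059 := by
      have e : samplingLoss M N * M =
          (1 - 1 / (M : ℝ) ^ 2) * (1 / M) * (1 / (2 * ((N : ℝ) * √N))) := by
        unfold samplingLoss
        field_simp
      have h1 : 1 / (2 * ((N : ℝ) * √N)) ≤ 1 / (2 * (2 * 1.4142)) := by gcongr
      have h2 : (1 - 1 / (M : ℝ) ^ 2) * (1 / M) ≤ 1 * (1 / 3) :=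
        mul_le_mul (by linarith [show 0 ≤ 1 / (M : ℝ) ^ 2 by positivity]) hM13 (by positivity)
          zero_le_one
      rw [e]
      refine (mul_le_mul h2 h1 (by positivity) (by norm_num)).trans (by norm_num)
    have hρM : stepLoss M N * M ≤ 1 / 18 := by
      have e : stepLoss M N * M =
          ((N : ℝ) - 1) / (N : ℝ) ^ 2 * ((1 + 1 / (M : ℝ)) * (1 / M)) / 2 := by
        unfold stepLoss
        push_cast
        field_simp
      have h1 : ((N : ℝ) - 1) / (N : ℝ) ^ 2 ≤ 1 / 4 := by
        rw [div_le_div_iff₀ (by positivity) (by norm_num)]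
        nlinarith [sq_nonneg ((N : ℝ) - 2)]
      have h2 : (1 + 1 / (M : ℝ)) * (1 / M) ≤ (1 + 1 / 3) * (1 / 3) := by gcongr
      have h3 := mul_le_mul h1 h2 (by positivity) (by norm_num)
      rw [e]
      linarith
    have hK : (M : ℝ) ^ 2 * 4 ≤ (((M * N) ^ 2 : ℕ) : ℝ) := by
      push_cast
      rw [mul_pow]
      gcongr
      nlinarith
    refine gainOutweighsLoss_of_le hM ?_ ?_ hρ0 ?_ hs0 ?_ ?_
    · have : (36 : ℝ) ≤ (((M * N) ^ 2 : ℕ) : ℝ) := by nlinarith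
      exact_mod_cast this
    · nlinarith
    · nlinarith
    · nlinarith
    · linarith

end SubmodularWelfare
end

/-! ### At least two agents and two items, and the theorem -/

noncomputable section
namespace SubmodularWelfare
open OracleAlg

theorem stepExpect_ge {M N : ℕ} (hM : 2 ≤ M) (hN : 2 ≤ N)
    {what w : Fin M → Finset (Fin N) → ℝ} {ε : ℝ} {pick : (Fin M → ℝ) → Fin M}
    (hw : ∀ i, IsValuation (w i)) (hε : ∀ i s, |what i s - w i s| ≤ ε)
    (hpick : ∀ (v : Fin M → ℝ) (i : Fin M), v i ≤ v (pick v)) :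
    (1 - 1 / Real.exp 1) * optWelfare w - 4 * (1 + 1 / (M : ℝ)) * N * ε ≤
      stepExpect what pick ((M * N) ^ 2) ((M * N) ^ 5) ((M * N) ^ 2) (fractionalWelfare w) := by
  have : NeZero M := ⟨by omega⟩
  have hM' : (2 : ℝ) ≤ M := by exact_mod_cast hM
  have hN' : (2 : ℝ) ≤ N := by exact_mod_cast hN
  have hε0 : 0 ≤ ε := (abs_nonneg _).trans (hε 0 ∅)
  have hW := optWelfare_nonneg hw
  have hmain := gainOutweighsLoss hM hN
  have hP : 0 < M * N := by positivity
  have hZ : 0 < (M * N) ^ 5 := by positivity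
  have hK : 0 < (M * N) ^ 2 := by positivity
  have hM1 : 1 / (M : ℝ) ≤ 1 / 2 := by gcongr
  have hM0 : 0 ≤ 1 / (M : ℝ) := by positivity
  have hMN : (4 : ℝ) ≤ M * N := by nlinarith
  have hKr : ((M : ℝ) * N) ^ 2 = (((M * N) ^ 2 : ℕ) : ℝ) := by push_cast; rfl
  have hm : (1 + 1 / (M : ℝ)) / (((M * N) ^ 2 : ℕ) : ℝ) ≤ 1 := by
    rw [← hKr, div_le_one (by positivity)]
    nlinarith
  have hρ0 : 0 ≤ stepLoss M N := by
    unfold stepLoss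
    have : (0 : ℝ) ≤ N - 1 := by linarith
    positivity
  have hρ1 : 0 ≤ 1 - stepLoss M N := by
    have h1 : ((N : ℝ) - 1) * ((1 + 1 / (M : ℝ)) / (((M * N) ^ 2 : ℕ) : ℝ)) ≤ 2 := by
      rw [← hKr, ← mul_div_assoc, div_le_iff₀ (by positivity)]
      nlinarith
    unfold stepLoss
    linarith
  -- With `Z = (MN)^5`, `√Z = (MN)^2 √M √N`. The factor `√M` of the selection bound cancels, and `(1
  -- + 1/M)(1 - 1/M)` gives the numerator of `samplingLoss`.
  have hloss : (1 + 1 / (M : ℝ)) * (N * (4 * ε + (1 - 1 / (M : ℝ)) *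
        (√M * (optWelfare w / (2 * √(((M * N) ^ 5 : ℕ) : ℝ)))))) =
      4 * (1 + 1 / (M : ℝ)) * N * ε + samplingLoss M N * optWelfare w := by
    have h1 : √(((M * N) ^ 5 : ℕ) : ℝ) = ((M : ℝ) * N) ^ 2 * (√M * √N) := by
      rw [← Real.sqrt_mul (by positivity), Real.sqrt_eq_iff_mul_self_eq (by positivity)
        (by positivity)]
      have h2 := Real.mul_self_sqrt (show 0 ≤ (M : ℝ) * N by positivity)
      push_cast
      linear_combination -((M : ℝ) * N) ^ 4 * h2
    have h3 : √(M : ℝ) ≠ 0 := by positivity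
    have h4 : √(N : ℝ) ≠ 0 := by positivity
    rw [h1]
    unfold samplingLoss
    field_simp
    ring
  set K := (M * N) ^ 2 with hKdef
  set Z := (M * N) ^ 5
  set L := 4 * (1 + 1 / (M : ℝ)) * N * ε + samplingLoss M N * optWelfare w with hL
  set l := (1 - stepLoss M N) / K with hl
  set E : ℕ → ((Fin M → Fin N → ℝ) → ℝ) → ℝ := stepExpect what pick K Z with hE
  have hK1 : (1 : ℝ) ≤ K := by exact_mod_cast hK
  have hl0 : 0 ≤ l := div_nonneg hρ1 (by linarith)
  have hl1 : l ≤ 1 := div_le_one_of_le₀ (by linarith) (by linarith)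
  have hMsq : 1 / (M : ℝ) ^ 2 ≤ 1 := by
    rw [div_le_one (by positivity)]; nlinarith
  have hs0 : 0 ≤ samplingLoss M N := div_nonneg (by linarith) (by positivity)
  have hL0 : 0 ≤ L := by positivity
  have key := recursion_bound (K := K) hl0 hl1 hL0
    (G := fun k => optWelfare w - E k (fractionalWelfare w))
    (Ω := fun k => E k fun y => ∑ j, bestMarginal w y j)
    (B := fun k => E k (expectedBonus what w pick Z))
    (S := fun k => E k fun y => ∑ j, excess K k y j * bestMarginal w y j)
    (φ := evenBonus M K) ?_ ?_ ?_ ?_ ?_ ?_ (evenBonus_nonneg M K)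
  · have h0 : E 0 (fractionalWelfare w) = 0 := fractionalWelfare_zero hw
    simp only [h0, sub_zero] at key
    unfold GainOutweighsLoss at hmain
    rw [← hl] at hmain
    set Γ := l * ∑ k ∈ Finset.range K, evenBonus M K k * (1 - l) ^ k
    have hΓ : 0 ≤ Γ := mul_nonneg hl0 (Finset.sum_nonneg fun k _ =>
      mul_nonneg (evenBonus_nonneg M K k) (pow_nonneg (by linarith) k))
    have h1 := mul_le_mul_of_nonneg_right hmain hW
    have h2 : 0 ≤ (1 - l) ^ K * (4 * (1 + 1 / (M : ℝ)) * N * ε) :=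
      mul_nonneg (pow_nonneg (by linarith) K) (by positivity)
    -- The sampling loss inside `L` on the left cancels the `- samplingLoss` on the right, so the
    -- final gap is at most OPT/e plus the noise term.
    have h3 : (optWelfare w - E K (fractionalWelfare w) - L) * (1 + Γ) ≤
        ((1 / Real.exp 1 - samplingLoss M N) * optWelfare w) * (1 + Γ) := by
      rw [hL] at key ⊢
      linarith
    have h4 := le_of_mul_le_mul_right h3 (by linarith)
    linarith
  · intro k hk
    have h1 : E k (fractionalWelfare w) + l * (E k (fun y => ∑ j, bestMarginal w y j) +
          E k (expectedBonus what w pick Z) - L) =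
        E k fun y => fractionalWelfare w y + l * (∑ j, bestMarginal w y j +
          expectedBonus what w pick Z y - L) := by
      simp only [hE, stepExpect, expect_add, expect_const_mul, expect_sub, expect_const]
    have h2 : E k (fractionalWelfare w) + l * (E k (fun y => ∑ j, bestMarginal w y j) +
          E k (expectedBonus what w pick Z) - L) ≤ E (k + 1) (fractionalWelfare w) := by
      rw [h1, hE, stepExpect_succ]
      refine stepExpect_mono fun y hy => ?_
      have h3 := le_expect_fractionalWelfare_raise (Z := Z) hw hε hpick hZ hK hm hρ1 hk hy
      rw [hloss] at h3
      exact h3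
    linarith
  · intro k hk
    have h1 : optWelfare w - E k (fractionalWelfare w) =
        E k fun y => optWelfare w - fractionalWelfare w y := by
      simp only [hE, stepExpect, expect_sub, expect_const]
    simp only [h1]
    refine stepExpect_mono fun y hy => ?_
    have := optWelfare_le_add_bestMarginal hw hy.nonneg (hy.le_one hk.le)
    linarith
  · intro k hk
    have h1 : E k (fun y => ∑ j, excess K k y j * bestMarginal w y j) +
          E k (expectedBonus what w pick Z) -
          evenBonus M K k * E k (fun y => ∑ j, bestMarginal w y j) =
        E k fun y => ∑ j, excess K k y j * bestMarginal w y j + expectedBonus what w pick Z y -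
          evenBonus M K k * ∑ j, bestMarginal w y j := by
      simp only [hE, stepExpect, expect_add, expect_const_mul, expect_sub]
    simp only [h1]
    rw [hE, stepExpect_succ]
    exact stepExpect_mono fun y hy => expect_excess_raise_le hw hK hk hy
  · change ∑ j, excess K 0 (0 : Fin M → Fin N → ℝ) j * bestMarginal w 0 j = 0
    refine Finset.sum_eq_zero fun j _ => ?_
    rw [show excess K 0 (0 : Fin M → Fin N → ℝ) j = 0 by simp [excess, bonusSum], zero_mul]
  · have h1 : (0 : ℝ) = E K fun _ => 0 := by simp only [hE, stepExpect, expect_const]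
    rw [h1]
    refine stepExpect_mono fun y hy => Finset.sum_nonneg fun j _ => mul_nonneg
      (excess_nonneg hK (by omega) le_rfl hy j)
      (bestMarginal_nonneg hw hy.nonneg (hy.le_one le_rfl) j)
  · intro k hk
    have h1 : (0 : ℝ) = E k fun _ => 0 := by simp only [hE, stepExpect, expect_const]
    refine h1.le.trans (stepExpect_mono fun y hy => ?_)
    have h2 : (0 : ℝ) = expect what (draws Z y) fun _ => 0 := by simp
    rw [h2]
    exact expect_mono _ fun x => Finset.sum_nonneg fun j _ => mul_nonneg
      (bonus_nonneg (hy.nonneg _ _))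
      (bestMarginal_nonneg hw hy.nonneg (hy.le_one hk.le) j)

end SubmodularWelfare
end

theorem mainTheorem2 (M N : ℕ) (hM : 0 < M) (hN : 0 < N)
    (pick : (Fin M → ℝ) → Fin M) (hpick : ∀ (v : Fin M → ℝ) (i : Fin M), v i ≤ v (pick v))
    (ε : ℝ) (hε : ε ≤ 1 / ((M : ℝ) * (N : ℝ)) ^ 2) :
    SubmodularWelfare.IsResilient
      (SubmodularWelfare.continuousGreedy (M := M) (N := N) pick ((M * N) ^ 2) ((M * N) ^ 5))
      (1 - 1 / Real.exp 1)
      (4 * (M : ℝ) * (N : ℝ) + 2 * (M : ℝ))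
      ((M * N) ^ 8) ε := by
  intro w what hw hwhat
  have : NeZero M := ⟨hM.ne'⟩
  have hM1 : (1 : ℝ) ≤ M := by exact_mod_cast hM
  have hN1 : (1 : ℝ) ≤ N := by exact_mod_cast hN
  have hε0 : 0 ≤ ε := (abs_nonneg _).trans (hwhat 0 ∅)
  refine ⟨?_, fun S hS => SubmodularWelfare.OracleAlg.always_mem_support
    (SubmodularWelfare.always_feasible_continuousGreedy pick _ _) hS, ?_⟩
  · refine (SubmodularWelfare.calls_continuousGreedy_le pick _ _).trans (le_of_eq ?_)
    ring
  rw [SubmodularWelfare.expectedWelfare_continuousGreedy]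
  rcases Nat.eq_or_lt_of_le (show 1 ≤ M from hM) with h | hM2
  · obtain rfl : M = 1 := h.symm
    have h1 := SubmodularWelfare.optWelfare_le_stepExpect_of_single_agent (Z := (1 * N) ^ 5)
      (what := what) hw pick (K := (1 * N) ^ 2) (by positivity)
    have h2 := SubmodularWelfare.optWelfare_nonneg hw
    have h3 : 0 ≤ 1 / Real.exp 1 * SubmodularWelfare.optWelfare w := by positivity
    have h4 : 0 ≤ (4 * ((1 : ℕ) : ℝ) * (N : ℝ) + 2 * ((1 : ℕ) : ℝ)) * ε := by positivity
    refine le_trans ?_ h1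
    rw [sub_mul, one_mul]
    exact (sub_le_self _ h4).trans (sub_le_self _ h3)
  rcases Nat.eq_or_lt_of_le (show 1 ≤ N from hN) with h | hN2
  · obtain rfl : N = 1 := h.symm
    have h1 := SubmodularWelfare.stepExpect_ge_single_item (Z := (M * 1) ^ 5)
      (K := (M * 1) ^ 2) hw hwhat hpick (by positivity) (by positivity)
    have h2 : 4 * ε ≤ (4 * (M : ℝ) * ((1 : ℕ) : ℝ) + 2 * (M : ℝ)) * ε := by
      gcongr
      push_cast
      linarith
    exact (sub_le_sub_left h2 _).trans h1
  · have h1 := SubmodularWelfare.stepExpect_ge hM2 hN2 hw hwhat hpick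
    have hM2' : (2 : ℝ) ≤ M := by exact_mod_cast hM2
    have h2 : 4 * (1 + 1 / (M : ℝ)) * N * ε ≤ (4 * (M : ℝ) * (N : ℝ) + 2 * (M : ℝ)) * ε := by
      have h3 : 1 / (M : ℝ) ≤ 1 := by rw [div_le_one (by linarith)]; exact hM1
      gcongr
      nlinarith
    exact (sub_le_sub_left h2 _).trans h1
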